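/- Let $\mathcal P\subseteq\mathbb Z_{\ge 0}$ and, for $i\ge 0$, write $\mathcal P-i=\{n-i\mid n\in\mathcal P\}\setminus\mathbb Z_{<0}$ and $e_{\mathcal P}(z)=\sum_{n\in\mathcal P}z^n/n!$. In a tree with a root, the preimages of a node are its neighbors that are further from the root than the node itself. Let $$T^{\mathcal P}(z)=\sum_{n\ge 0}\frac{t_n}{n!}z^n,$$ where $t_n$ is the number of rooted trees with vertex set $\{1,\dots,n\}$ in which the number of preimages of every node belongs to $\mathcal P$. A complex power series $\epsilon$ with radius of convergence $R>0$ satisfies the H-schema if (i) $\epsilon(0)\ne 0$ and $\epsilon$ is not of the form $\epsilon_0+\epsilon_1z$; (ii) all its coefficients are nonnegative reals; (iii) there is a unique real $\tau$ with $0<\tau<R$ and $\epsilon(\tau)-\tau\epsilon'(\tau)=0$. For $R>1$ and $0<\phi<\pi/2$ let $\Delta(\phi,R)=\{z\in\mathbb C\mid |z|<R,\ z\ne 1,\ |\arg(z-1)|>\phi\}$; a function is $\Delta$-analytic if it is analytic in some $\Delta(\phi,R)$. Write $f\sim g$ if $f/g\to 1$, and let $w^{1/2}$ be the principal branch. Assume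 $0\in\mathcal P$ and $\mathcal P-2\neq\emptyset$. Then $e_{\mathcal P}$ satisfies the H-schema, and there is a unique real $\tau_{\mathcal P}>0$ with $e_{\mathcal P}(\tau_{\mathcal P})-\tau_{\mathcal P}e_{\mathcal P}'(\tau_{\mathcal P})=0$. Put $\rho_{\mathcal P}=\tau_{\mathcal P}/e_{\mathcal P}(\tau_{\mathcal P})$. The power series $T^{\mathcal P}$ has radius of convergence $\rho_{\mathcal P}>0$, and the function it defines on the disc $|z|<\rho_{\mathcal P}$ extends to a function, again denoted $T^{\mathcal P}$, with the following properties. It is analytic on the union of that disc with some open disc around $\rho_{\mathcal P}$ slit along $\mathbb R_{\ge\rho_{\mathcal P}}$. As $z\to\rho_{\mathcal P}$ in $\mathbb C\setminus\mathbb R_{\ge\rho_{\mathcal P}}$ (in particular, as $z$ tends to $\rho_{\mathcal P}$ from below along the reals), $$T^{\mathcal P}(z)\sim \tau_{\mathcal P}-\sqrt{\frac{2e_{\mathcal P}(\tau_{\mathcal P})}{e_{\mathcal P-2}(\tau_{\mathcal P})}}\Big(1-\frac z{\rho_{\mathcal P}}\Big)^{1/2},\qquad \tau_{\mathcal P}-T^{\mathcal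 P}(z)\sim \sqrt{\frac{2e_{\mathcal P}(\tau_{\mathcal P})}{e_{\mathcal P-2}(\tau_{\mathcal P})}}\Big(1-\frac z{\rho_{\mathcal P}}\Big)^{1/2}.$$ If, in addition, $\gcd(\mathcal P)=1$, then there is an $r>\rho_{\mathcal P}$ such that $T^{\mathcal P}$ is analytic on the open disc of radius $r$ around $0$ slit along $\mathbb R_{\ge\rho_{\mathcal P}}$, and $z\mapsto T^{\mathcal P}(\rho_{\mathcal P}z)$ is $\Delta$-analytic. -/

import Mathlib

open Filter Topology

noncomputable section

/-! ### Power series as functions -/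

/-- The value at `x` of the power series `f`, as a sum of its terms. -/
def seriesEval {𝕜 : Type*} [NormedField 𝕜] (f : PowerSeries 𝕜) (x : 𝕜) : 𝕜 :=
  ∑' n : ℕ, PowerSeries.coeff n f * x ^ n

/-- The radius of convergence of a complex power series. -/
def seriesRadius (f : PowerSeries ℂ) : ENNReal :=
  (FormalMultilinearSeries.ofScalars ℂ (fun n : ℕ => PowerSeries.coeff n f)).radius

/-! ### Truncated exponentials -/

open Classical in
/-- The series `e_P`, the sum of `z ^ n / n!` over the elements `n` of `P`. -/
def truncExp (𝕜 : Type*) [NormedField 𝕜] (P : Set ℕ) : PowerSeries 𝕜 :=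
  PowerSeries.mk fun n => if n ∈ P then ((n.factorial : ℕ) : 𝕜)⁻¹ else 0

/-- The set `P - i`: subtract `i` from every element of `P`, keep the nonnegative results. -/
def shiftDown (P : Set ℕ) (i : ℕ) : Set ℕ := {m | ∃ n ∈ P, (n : ℤ) - (i : ℤ) = (m : ℤ)}

/-- `τ` is a positive real solution of `e_P(τ) - τ e_P'(τ) = 0`. -/
def IsCharacteristicRoot (P : Set ℕ) (τ : ℝ) : Prop :=
  0 < τ ∧ seriesEval (truncExp ℝ P) τ - τ * deriv (seriesEval (truncExp ℝ P)) τ = 0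

/-- The number `τ_P`: the positive solution of `e_P(τ) - τ e_P'(τ) = 0`
(meaningful when there is exactly one). -/
def tauP (P : Set ℕ) : ℝ := Classical.epsilon (IsCharacteristicRoot P)

/-- The number `ρ_P = τ_P / e_P(τ_P)`. -/
def rhoP (P : Set ℕ) : ℝ := tauP P / seriesEval (truncExp ℝ P) (tauP P)

/-! ### The H-schema -/

/-- A power series with positive radius of convergence `R` satisfies the H-schema if it has a
nonzero constant term, is not a polynomial of degree at most one, has nonnegative real
coefficients, and `ε(τ) - τ ε'(τ) = 0` has exactly one solution with `0 < τ < R`. -/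
structure HSchema (ε : PowerSeries ℂ) : Prop where
  analytic_at_zero : 0 < seriesRadius ε
  eval_zero_ne : seriesEval ε 0 ≠ 0
  not_affine : ¬ ∃ a b : ℂ, ε = PowerSeries.C a + PowerSeries.C b * PowerSeries.X
  coeff_nonneg : ∀ n : ℕ, ∃ a : ℝ, 0 ≤ a ∧ PowerSeries.coeff n ε = (a : ℂ)
  existsUnique_root : ∃! τ : ℝ, 0 < τ ∧ ENNReal.ofReal τ < seriesRadius ε ∧
    seriesEval ε (τ : ℂ) - (τ : ℂ) * deriv (seriesEval ε) (τ : ℂ) = 0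

/-! ### Labeled rooted trees with a preimage constraint -/

/-- The preimages of the node `v` in the graph `G` with root `r`: the neighbors of `v` that are
further from the root than `v`. -/
def preimageNodes {n : ℕ} (G : SimpleGraph (Fin n)) (r v : Fin n) : Set (Fin n) :=
  {w | G.Adj v w ∧ G.dist r v < G.dist r w}

/-- The labeled rooted trees with `n` nodes in which the number of preimages of every node
belongs to `P`: a tree on the label set `Fin n` together with a root. -/
def constrainedTrees (P : Set ℕ) (n : ℕ) : Set (SimpleGraph (Fin n) × Fin n) :=
  {t | t.1.IsTree ∧ ∀ v : Fin n, (preimageNodes t.1 t.2 v).ncard ∈ P}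

/-- The exponential generating function `T^P` of the labeled rooted trees in which the number
of preimages of every node belongs to `P`. -/
def treeSeries (P : Set ℕ) : PowerSeries ℂ :=
  PowerSeries.mk fun n => ((constrainedTrees P n).ncard : ℂ) / ((n.factorial : ℕ) : ℂ)

/-! ### Asymptotics and slit domains -/

/-- `f ∼ g` along the filter `l`: the quotient `f / g` tends to `1`. -/
def SimAlong (l : Filter ℂ) (f g : ℂ → ℂ) : Prop :=
  Tendsto (fun z => f z / g z) l (𝓝 1)

/-- The ray of real numbers `x ≥ ρ`, as a subset of the complex plane. -/
def realRay (ρ : ℝ) : Set ℂ := {z | ∃ x : ℝ, ρ ≤ x ∧ z = (x : ℂ)}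

/-- The domain `Δ(φ, R)`. -/
def deltaDomain (φ R : ℝ) : Set ℂ :=
  {z | ‖z‖ < R ∧ z ≠ 1 ∧ φ < |Complex.arg (z - 1)|}

/-- A function is `Δ`-analytic if it is analytic in some `Δ(φ, R)` with `1 < R` and
`0 < φ < π / 2`. -/
def IsDeltaAnalytic (f : ℂ → ℂ) : Prop :=
  ∃ φ R : ℝ, 0 < φ ∧ φ < Real.pi / 2 ∧ 1 < R ∧ AnalyticOnNhd ℂ f (deltaDomain φ R)

/-- The function `c (1 - z / ρ) ^ (1 / 2)` (principal branch) with `ρ = ρ_P` and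
`c = √(2 e_P(τ_P) / e_{P-2}(τ_P))`. -/
def sqrtTerm (P : Set ℕ) (z : ℂ) : ℂ :=
  (Real.sqrt (2 * seriesEval (truncExp ℝ P) (tauP P) /
      seriesEval (truncExp ℝ (shiftDown P 2)) (tauP P)) : ℂ) *
    (1 - z / (rhoP P : ℂ)) ^ ((1 : ℂ) / 2)

end

/-! A rooted tree is a root carrying the trees that hang from its children, so `T = z e_P(T)`: the
function `T` inverts `ψ(u) = u / e_P(u)`. The analytic statements come from the shape of `ψ`. Since
`(e_P - u e_P')' = -u e_{P-2}`, the map `ψ` increases on `[0, τ]` from `0` to `ρ` and has a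
nondegenerate critical point at `τ`.

Counting: trees are encoded by parent maps. Deleting the roots of a forest gives a recursion
(`card_parentMaps`), and the coefficients of the powers of the formal solution of `W = e_P(X W)`
satisfy the same one (`coeff_pow_of_eq_subst`); hence `T = X W`.

Closed disc: `ρ e_P(τ) = τ` keeps all partial sums of `T` at `ρ` below `τ`
(`partialNorm_treeSeries_le`), so `T` converges absolutely up to the circle, solves the equation
there, and `T(ρ) = τ`. As `ρ e_P'(τ) = 1`, differentiating the equation at `ρ` is contradictory, so
the radius of convergence is exactly `ρ`.

Singularity: near `τ`, `1 - ψ(u)/ρ = q(u)^2` with `q` analytic and `q'(τ) ≠ 0`. Inverting `q` gives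
`T = q⁻¹((1 - z/ρ)^(1/2))` (`exists_sqrt_extension`).

Other boundary points: if `gcd P = 1`, the equality case of the triangle inequality gives `|T(z)| <
τ`, hence `ψ'(T(z)) ≠ 0` and `T` continues across `z`. Compactness of the rest of the circle and the
identity theorem glue the continuations (`exists_extension_slit_ball`). -/

noncomputable section

/-! ### Counting parent maps -/

section ParentMaps

variable {V : Type*} [Fintype V] [DecidableEq V]

open Classical in
/-- The maps from `S` to `R` all of whose fibres have a cardinality in `P`, extended by the
identity outside of `S`. -/
def childMaps (P : Set ℕ) (S R : Finset V) : Finset (V → V) :=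
  Finset.univ.filter fun p => (∀ v ∉ S, p v = v) ∧ (∀ v ∈ S, p v ∈ R) ∧
    ∀ v ∈ R, (S.filter fun w => p w = v).card ∈ P

open Classical in
/-- The parent maps of the rooted forests with node set `U` and set of roots `R` in which every
node has a number of children belonging to `P`. -/
def parentMaps (P : Set ℕ) (U R : Finset V) : Finset (V → V) :=
  Finset.univ.filter fun p => (∀ v ∉ U \ R, p v = v) ∧ (∀ v ∈ U \ R, p v ∈ U) ∧
    (∀ A ⊆ U \ R, (∀ v ∈ A, p v ∈ A) → A = ∅) ∧
    ∀ v ∈ U, ((U \ R).filter fun w => p w = v).card ∈ P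

lemma mem_childMaps {P : Set ℕ} {S R : Finset V} {p : V → V} :
    p ∈ childMaps P S R ↔ (∀ v ∉ S, p v = v) ∧ (∀ v ∈ S, p v ∈ R) ∧
      ∀ v ∈ R, (S.filter fun w => p w = v).card ∈ P := by
  simp [childMaps]

lemma mem_parentMaps {P : Set ℕ} {U R : Finset V} {p : V → V} :
    p ∈ parentMaps P U R ↔ (∀ v ∉ U \ R, p v = v) ∧ (∀ v ∈ U \ R, p v ∈ U) ∧
      (∀ A ⊆ U \ R, (∀ v ∈ A, p v ∈ A) → A = ∅) ∧
      ∀ v ∈ U, ((U \ R).filter fun w => p w = v).card ∈ P := by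
  simp only [parentMaps, Finset.mem_filter, Finset.mem_univ, true_and]

-- Peels off the fibre `A` over `r`: the rest of the map sends `S \ A` to `R`.
open Classical in
lemma card_childMaps_insert (P : Set ℕ) (S R : Finset V) {r : V} (hr : r ∉ R) :
    (childMaps P S (insert r R)).card =
      ∑ A ∈ S.powerset, if A.card ∈ P then (childMaps P (S \ A) R).card else 0 := by
  rw [Finset.card_eq_sum_card_fiberwise (f := fun p : V → V => S.filter fun w => p w = r)
    (t := S.powerset) (fun p _ => Finset.mem_powerset.2 (Finset.filter_subset _ _))]
  refine Finset.sum_congr rfl fun A hA => ?_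
  rw [Finset.mem_powerset] at hA
  split_ifs with hAP
  · refine Finset.card_nbij' (fun p => A.piecewise id p) (fun p => A.piecewise (fun _ => r) p)
      ?_ ?_ ?_ ?_
    · intro p hp
      simp only [Finset.coe_filter, Set.mem_ofPred_eq, mem_childMaps] at hp
      obtain ⟨⟨h1, h2, h3⟩, rfl⟩ := hp
      simp only [Finset.mem_coe, mem_childMaps]
      refine ⟨fun v hv => ?_, fun v hv => ?_, fun v hv => ?_⟩
      · by_cases hvA : v ∈ S.filter fun w => p w = r
        · simp [Finset.piecewise_eq_of_mem _ _ _ hvA]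
        · rw [Finset.piecewise_eq_of_notMem _ _ _ hvA]
          exact h1 v (by grind)
      · have hvA : v ∉ S.filter fun w => p w = r := by grind
        rw [Finset.piecewise_eq_of_notMem _ _ _ hvA]
        have := h2 v (by grind)
        grind
      · convert h3 v (by grind) using 2
        ext w
        simp only [Finset.mem_filter, Finset.mem_sdiff, Finset.piecewise]
        grind
    · intro p hp
      simp only [Finset.mem_coe, mem_childMaps] at hp
      obtain ⟨h1, h2, h3⟩ := hp
      have hfib : (S.filter fun w => A.piecewise (fun _ => r) p w = r) = A := by
        ext w
        simp only [Finset.mem_filter, Finset.piecewise]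
        grind
      simp only [Finset.coe_filter, Set.mem_ofPred_eq, mem_childMaps, hfib, and_true]
      refine ⟨fun v hv => ?_, fun v hv => ?_, fun v hv => ?_⟩
      · simp only [Finset.piecewise]
        grind
      · simp only [Finset.piecewise]
        grind
      · rcases Finset.mem_insert.1 hv with rfl | hv
        · rwa [hfib]
        · convert h3 v hv using 2
          ext w
          simp only [Finset.mem_filter, Finset.mem_sdiff, Finset.piecewise]
          grind
    · intro p hp
      simp only [Finset.coe_filter, Set.mem_ofPred_eq, mem_childMaps] at hp
      obtain ⟨⟨h1, h2, h3⟩, rfl⟩ := hp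
      ext v
      simp only [Finset.piecewise]
      grind
    · intro p hp
      simp only [Finset.mem_coe, mem_childMaps] at hp
      obtain ⟨h1, h2, h3⟩ := hp
      ext v
      simp only [Finset.piecewise]
      grind
  · rw [Finset.card_eq_zero, Finset.filter_eq_empty_iff]
    rintro p hp rfl
    exact hAP ((mem_childMaps.1 hp).2.2 r (Finset.mem_insert_self _ _))

/-- Distributing `S` over `R` labelled fibres with sizes in `P` is a labelled product of `R.card`
copies of `e_P`. The induction on `R` compares the previous recursion with the Cauchy product. -/
lemma card_childMaps (P : Set ℕ) (S R : Finset V) :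
    ((childMaps P S R).card : ℂ) =
      (S.card.factorial : ℂ) * PowerSeries.coeff S.card (truncExp ℂ P ^ R.card) := by
  classical
  induction R using Finset.induction_on generalizing S with
  | empty =>
    rcases S.eq_empty_or_nonempty with rfl | ⟨s, hs⟩
    · have : childMaps P (∅ : Finset V) ∅ = {id} := by
        ext p
        simp [mem_childMaps, funext_iff]
      simp [this]
    · have : childMaps P S ∅ = ∅ := by
        rw [Finset.eq_empty_iff_forall_notMem]
        intro p hp
        simpa using (mem_childMaps.1 hp).2.1 s hs
      simp [this, PowerSeries.coeff_one, Finset.card_ne_zero_of_mem hs]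
  | insert r R hr ih =>
    rw [card_childMaps_insert P S R hr, Finset.card_insert_of_notMem hr, pow_succ',
      PowerSeries.coeff_mul, Finset.Nat.sum_antidiagonal_eq_sum_range_succ_mk, Finset.mul_sum]
    push_cast
    have key := Finset.sum_powerset_apply_card (x := S) (fun j => if j ∈ P then
      ((S.card - j).factorial : ℂ) * PowerSeries.coeff (S.card - j) (truncExp ℂ P ^ R.card)
      else 0)
    rw [Finset.sum_congr rfl (g := fun A : Finset V => (fun j => if j ∈ P then
      ((S.card - j).factorial : ℂ) * PowerSeries.coeff (S.card - j) (truncExp ℂ P ^ R.card)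
      else 0) A.card), key]
    · refine Finset.sum_congr rfl fun j hj => ?_
      have hj' : j ≤ S.card := by simpa [Nat.lt_succ_iff] using hj
      by_cases hjP : j ∈ P
      · have hne : (j.factorial : ℂ) ≠ 0 := by exact_mod_cast j.factorial_ne_zero
        simp only [hjP, if_true, truncExp, PowerSeries.coeff_mk, nsmul_eq_mul]
        rw [← Nat.choose_mul_factorial_mul_factorial hj']
        push_cast
        field_simp
      · simp [hjP, truncExp]
    · intro A hA
      rw [Finset.mem_powerset] at hA
      simp only [ih, Finset.card_sdiff_of_subset hA]

/-- Delete the roots: with `S` the set of their children, what remains is a forest on `U \ R` with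
root set `S`, and the deleted part is a map from `S` to `R`. -/
lemma card_parentMaps (P : Set ℕ) {U R : Finset V} (hR : R ⊆ U) :
    (parentMaps P U R).card =
      ∑ S ∈ (U \ R).powerset, (childMaps P S R).card * (parentMaps P (U \ R) S).card := by
  classical
  rw [Finset.card_eq_sum_card_fiberwise (f := fun p : V → V => (U \ R).filter fun w => p w ∈ R)
    (t := (U \ R).powerset) (fun p _ => Finset.mem_powerset.2 (Finset.filter_subset _ _))]
  refine Finset.sum_congr rfl fun S hS => ?_
  rw [Finset.mem_powerset] at hS
  rw [← Finset.card_product]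
  refine Finset.card_nbij' (fun p => (S.piecewise p id, S.piecewise id p))
    (fun p => S.piecewise p.1 p.2) ?_ ?_ ?_ ?_
  · intro p hp
    simp only [Finset.coe_filter, Set.mem_ofPred_eq, mem_parentMaps] at hp
    obtain ⟨⟨h1, h2, h3, h4⟩, rfl⟩ := hp
    simp only [Finset.coe_product, Set.mem_prod, Finset.mem_coe, mem_parentMaps, mem_childMaps]
    refine ⟨⟨fun v hv => ?_, fun v hv => ?_, fun v hv => ?_⟩,
      fun v hv => ?_, fun v hv => ?_, fun A hA hpA => ?_, fun v hv => ?_⟩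
    · simp [Finset.piecewise_eq_of_notMem _ _ _ hv]
    · rw [Finset.piecewise_eq_of_mem _ _ _ hv]
      exact (Finset.mem_filter.1 hv).2
    · convert h4 v (hR hv) using 2
      ext w
      simp only [Finset.mem_filter, Finset.piecewise]
      grind
    · simp only [Finset.piecewise]
      grind
    · simp only [Finset.piecewise]
      grind
    · refine h3 A (fun v hv => by grind) fun v hv => ?_
      have := hpA v hv
      rwa [Finset.piecewise_eq_of_notMem] at this
      grind
    · convert h4 v (by grind) using 2
      ext w
      simp only [Finset.mem_filter, Finset.piecewise]
      grind
  · rintro ⟨p, q⟩ hp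
    simp only [Finset.coe_product, Set.mem_prod, Finset.mem_coe, mem_parentMaps,
      mem_childMaps] at hp
    obtain ⟨⟨h1, h2, h3⟩, h4, h5, h6, h7⟩ := hp
    simp only [Finset.coe_filter, Set.mem_ofPred_eq, mem_parentMaps]
    refine ⟨⟨fun v hv => ?_, fun v hv => ?_, fun A hA hpA => ?_, fun v hv => ?_⟩, ?_⟩
    · simp only [Finset.piecewise]
      grind
    · simp only [Finset.piecewise]
      grind
    -- A closed set avoids `S`, because `p` sends `S` into `R`; it is therefore closed for the
    -- smaller forest.
    · have hAS : ∀ v ∈ A, v ∉ S := fun v hv hvS => by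
        have := hpA v hv
        rw [Finset.piecewise_eq_of_mem _ _ _ hvS] at this
        have := hA this
        have := h2 v hvS
        grind
      refine h6 A (fun v hv => ?_) fun v hv => ?_
      · have := hA hv
        have := hAS v hv
        grind
      · have := hpA v hv
        rwa [Finset.piecewise_eq_of_notMem _ _ _ (hAS v hv)] at this
    · by_cases hvR : v ∈ R
      · convert h3 v hvR using 2
        ext w
        simp only [Finset.mem_filter, Finset.piecewise]
        grind
      · convert h7 v (by grind) using 2
        ext w
        simp only [Finset.mem_filter, Finset.piecewise]
        grind
    · ext w
      simp only [Finset.piecewise]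
      grind
  · intro p hp
    ext v
    simp only [Finset.piecewise]
    split_ifs <;> rfl
  · rintro ⟨p, q⟩ hp
    simp only [Finset.coe_product, Set.mem_prod, Finset.mem_coe, mem_parentMaps,
      mem_childMaps] at hp
    obtain ⟨⟨h1, h2, h3⟩, h4, h5, h6, h7⟩ := hp
    simp only [Prod.mk.injEq]
    constructor
    · ext v
      simp only [Finset.piecewise]
      grind
    · ext v
      simp only [Finset.piecewise]
      grind

/-- Without roots, `U` itself would be a nonempty closed set. -/
lemma parentMaps_empty_right (P : Set ℕ) {U : Finset V} (hU : U.Nonempty) :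
    parentMaps P U ∅ = ∅ := by
  rw [Finset.eq_empty_iff_forall_notMem]
  intro p hp
  obtain ⟨-, h2, h3, -⟩ := mem_parentMaps.1 hp
  rw [Finset.sdiff_empty] at h2 h3
  exact hU.ne_empty (h3 U subset_rfl h2)

lemma parentMaps_self {P : Set ℕ} (h0 : 0 ∈ P) (U : Finset V) : parentMaps P U U = {id} := by
  ext p
  simp only [mem_parentMaps, Finset.sdiff_self, Finset.mem_singleton]
  simp +contextual [funext_iff, h0]

end ParentMaps

/-! ### The formal solution of the functional equation -/

section FormalSolution

open PowerSeries

lemma coeff_subst_X_mul (f W : ℂ⟦X⟧) (m : ℕ) :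
    coeff m (f.subst (X * W : ℂ⟦X⟧)) =
      ∑ s ∈ Finset.range (m + 1), coeff s f * coeff (m - s) (W ^ s) := by
  have hs : HasSubst (X * W : ℂ⟦X⟧) := HasSubst.of_constantCoeff_zero' (by simp)
  rw [coeff_subst' hs, finsum_eq_sum_of_support_subset (s := Finset.range (m + 1))]
  · refine Finset.sum_congr rfl fun s hsm => ?_
    have : s ≤ m := by simpa [Nat.lt_succ_iff] using hsm
    rw [mul_pow, coeff_X_pow_mul', if_pos this, smul_eq_mul]
  · intro s hsm
    simp only [Function.mem_support] at hsm
    by_contra hlt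
    apply hsm
    have : ¬ s ≤ m := by simpa [Nat.lt_succ_iff] using hlt
    rw [mul_pow, coeff_X_pow_mul', if_neg this, smul_zero]

/-- The equation `W = f(X W)` has a formal solution `W` when the constant term of `f` is
nonzero. -/
lemma exists_eq_subst_X_mul (f : ℂ⟦X⟧) (hf : constantCoeff f ≠ 0) :
    ∃ W : ℂ⟦X⟧, W = f.subst (X * W : ℂ⟦X⟧) := by
  -- The compositional inverse `Q` of `X / f` satisfies `Q = X f(Q)`, so `W = f(Q)` is a solution.
  have hP : constantCoeff (X * f⁻¹ : ℂ⟦X⟧) = 0 := by simp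
  have hP' : IsUnit (coeff 1 (X * f⁻¹ : ℂ⟦X⟧)) := by
    rw [show (1 : ℕ) = 0 + 1 from rfl, coeff_succ_X_mul]
    simpa using hf
  set Q := substInvOfIsUnit (X * f⁻¹) hP' with hQ
  have hQs : HasSubst Q := HasSubst.substInvOfIsUnit _ hP'
  have h := subst_substInvOfIsUnit_right _ hP hP'
  rw [← hQ, subst_mul hQs, subst_X hQs] at h
  have h1 : f.subst Q * (f⁻¹).subst Q = 1 := by
    rw [← subst_mul hQs, PowerSeries.mul_inv_cancel f hf, ← coe_substAlgHom hQs, map_one]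
  have h2 : Q = X * f.subst Q := by
    rw [← h, mul_assoc, mul_comm (subst Q f⁻¹), h1, mul_one]
  exact ⟨f.subst Q, by rw [← h2]⟩

/-- Obtained by raising the equation to the power `k`. This mirrors `card_parentMaps`: `k` roots,
`m` other nodes, and `s` of these are children of roots. -/
lemma coeff_pow_of_eq_subst {f W : ℂ⟦X⟧} (hW : W = f.subst (X * W : ℂ⟦X⟧)) (m k : ℕ) :
    coeff m (W ^ k) =
      ∑ s ∈ Finset.range (m + 1), coeff s (f ^ k) * coeff (m - s) (W ^ s) := by
  have hs : HasSubst (X * W : ℂ⟦X⟧) := HasSubst.of_constantCoeff_zero' (by simp)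
  rw [← coeff_subst_X_mul, subst_pow hs, ← hW]

end FormalSolution

/-- Both sides satisfy the same recursion. Deleting the roots shrinks `U` only if there are some, so
`R = ∅` is treated apart. -/
lemma card_parentMaps_eq {V : Type*} [Fintype V] [DecidableEq V] {P : Set ℕ} (h0 : 0 ∈ P)
    {W : PowerSeries ℂ}
    (hW : W = (truncExp ℂ P).subst (PowerSeries.X * W : PowerSeries ℂ)) {U R : Finset V}
    (hR : R ⊆ U) :
    ((parentMaps P U R).card : ℂ) =
      ((U \ R).card.factorial : ℂ) * PowerSeries.coeff (U \ R).card (W ^ R.card) := by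
  induction hn : U.card using Nat.strong_induction_on generalizing U R with
  | _ n ih =>
    rcases R.eq_empty_or_nonempty with rfl | hne
    · rcases U.eq_empty_or_nonempty with rfl | hU
      · simp [parentMaps_self h0]
      · simp [parentMaps_empty_right P hU, PowerSeries.coeff_one, hU.ne_empty]
    · have hlt : (U \ R).card < n := by
        rw [← hn]
        exact Finset.card_lt_card (Finset.sdiff_ssubset hR hne)
      rw [card_parentMaps P hR, coeff_pow_of_eq_subst hW, Finset.mul_sum]
      push_cast
      have key := Finset.sum_powerset_apply_card (x := U \ R) (fun s => (s.factorial : ℂ) *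
        PowerSeries.coeff s (truncExp ℂ P ^ R.card) *
        ((((U \ R).card - s).factorial : ℂ) *
          PowerSeries.coeff ((U \ R).card - s) (W ^ s)))
      rw [Finset.sum_congr rfl (g := fun S : Finset V => (fun s => (s.factorial : ℂ) *
        PowerSeries.coeff s (truncExp ℂ P ^ R.card) *
        ((((U \ R).card - s).factorial : ℂ) *
          PowerSeries.coeff ((U \ R).card - s) (W ^ s))) S.card), key]
      · refine Finset.sum_congr rfl fun s hs => ?_
        have hs' : s ≤ (U \ R).card := by simpa [Nat.lt_succ_iff] using hs
        rw [← Nat.choose_mul_factorial_mul_factorial hs', nsmul_eq_mul]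
        push_cast
        ring
      · intro S hS
        rw [Finset.mem_powerset] at hS
        simp only [card_childMaps, ih _ hlt hS rfl, Finset.card_sdiff_of_subset hS]

/-! ### Rooted trees and parent maps -/

section Trees

variable {V : Type*}

/-- The graph joining every node to its parent. -/
def parentGraph (p : V → V) : SimpleGraph V where
  Adj v w := v ≠ w ∧ (p v = w ∨ p w = v)
  symm := ⟨fun _ _ h => ⟨h.1.symm, h.2.symm⟩⟩
  loopless := ⟨fun _ h => h.1 rfl⟩

lemma parentGraph_adj {p : V → V} {v w : V} :
    (parentGraph p).Adj v w ↔ v ≠ w ∧ (p v = w ∨ p w = v) := Iff.rfl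

/-- A map fixing `r` without nonempty closed sets avoiding `r`: the parent map of a tree with
root `r`. -/
structure IsParentMap (p : V → V) (r : V) : Prop where
  map_root : p r = r
  eq_empty_of_closed : ∀ A : Finset V, r ∉ A → (∀ v ∈ A, p v ∈ A) → A = ∅

lemma mem_parentMaps_univ_singleton [Fintype V] [DecidableEq V] {P : Set ℕ} {p : V → V} {r : V} :
    p ∈ parentMaps P Finset.univ {r} ↔
      IsParentMap p r ∧ ∀ v, {w | w ≠ r ∧ p w = v}.ncard ∈ P := by
  have hcard : ∀ v, ((Finset.univ \ {r}).filter fun w => p w = v).card =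
      {w | w ≠ r ∧ p w = v}.ncard := fun v => by
    rw [← Set.ncard_coe_finset]
    congr 1
    ext w
    simp
  have hsub : ∀ A : Finset V, A ⊆ Finset.univ \ {r} ↔ r ∉ A := fun A => by
    simp [Finset.subset_sdiff]
  rw [mem_parentMaps]
  simp only [hcard, hsub, Finset.mem_univ, true_implies, implies_true, true_and]
  constructor
  · rintro ⟨h1, h2, h3⟩
    exact ⟨⟨h1 r (by simp), h2⟩, h3⟩
  · rintro ⟨⟨h1, h2⟩, h3⟩
    refine ⟨fun v hv => ?_, h2, h3⟩
    obtain rfl : v = r := by simpa using hv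
    exact h1

lemma SimpleGraph.Connected.exists_adj_dist_lt {G : SimpleGraph V} (hG : G.Connected) {r v : V}
    (hv : v ≠ r) : ∃ w, G.Adj v w ∧ G.dist r w < G.dist r v := by
  obtain ⟨q, hq⟩ := hG.exists_walk_length_eq_dist v r
  cases q with
  | nil => exact absurd rfl hv
  | cons h q =>
    refine ⟨_, h, ?_⟩
    rw [G.dist_comm (u := r), G.dist_comm (u := r), ← hq, SimpleGraph.Walk.length_cons]
    exact Nat.lt_succ_of_le (SimpleGraph.dist_le q)

namespace IsParentMap

variable {p : V → V} {r : V}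

lemma map_ne (h : IsParentMap p r) {v : V} (hv : v ≠ r) : p v ≠ v := fun hpv => by
  have := h.eq_empty_of_closed {v} (by simpa using hv.symm) (by simpa using hpv)
  simp at this

lemma adj (h : IsParentMap p r) {v : V} (hv : v ≠ r) : (parentGraph p).Adj v (p v) :=
  ⟨(h.map_ne hv).symm, Or.inl rfl⟩

variable [Fintype V]

lemma connected (h : IsParentMap p r) : (parentGraph p).Connected := by
  classical
  -- The nodes that cannot be reached from the root form a closed set.
  have key : (Finset.univ.filter fun v => ¬ (parentGraph p).Reachable r v) = ∅ := by
    refine h.eq_empty_of_closed _ (by simp) fun v hv => ?_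
    simp only [Finset.mem_filter, Finset.mem_univ, true_and] at hv ⊢
    have hvr : v ≠ r := by
      rintro rfl
      exact hv (SimpleGraph.Reachable.refl _)
    exact fun hr => hv (hr.trans (h.adj hvr).reachable.symm)
  have hreach : ∀ v, (parentGraph p).Reachable r v := fun v => by
    by_contra hv
    exact Finset.notMem_empty v (key ▸ by simpa using hv)
  exact { preconnected := fun v w => (hreach v).symm.trans (hreach w), nonempty := ⟨r⟩ }

/-- Every edge joins some `v ≠ r` to `p v`, so the connected graph has at most `|V| - 1` edges. -/
lemma isTree (h : IsParentMap p r) : (parentGraph p).IsTree := by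
  classical
  rw [SimpleGraph.isTree_iff_connected_and_card]
  refine ⟨h.connected, le_antisymm ?_ h.connected.card_vert_le_card_edgeSet_add_one⟩
  have hsub : (parentGraph p).edgeSet ⊆
      ((Finset.univ.erase r).image fun v => s(v, p v) : Finset (Sym2 V)) := by
    intro e
    induction e using Sym2.ind with
    | _ v w =>
      intro he
      simp only [SimpleGraph.mem_edgeSet, parentGraph_adj] at he
      obtain ⟨hne, rfl | rfl⟩ := he
      · simp only [Finset.coe_image, Set.mem_image, Finset.mem_coe]
        exact ⟨v, Finset.mem_erase.2 ⟨fun hv => hne (by rw [hv, h.map_root]),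
          Finset.mem_univ _⟩, rfl⟩
      · simp only [Finset.coe_image, Set.mem_image, Finset.mem_coe]
        exact ⟨w, Finset.mem_erase.2 ⟨fun hv => hne (by rw [hv, h.map_root]),
          Finset.mem_univ _⟩, Sym2.eq_swap⟩
  have h1 := Set.ncard_le_ncard hsub (Finset.finite_toSet _)
  rw [Set.ncard_coe_finset] at h1
  have h2 := h1.trans Finset.card_image_le
  rw [Finset.card_erase_of_mem (Finset.mem_univ r), Finset.card_univ] at h2
  have hpos : 0 < Fintype.card V := Fintype.card_pos_iff.2 ⟨r⟩
  rw [Nat.card_eq_fintype_card (α := V)]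
  change (parentGraph p).edgeSet.ncard + 1 ≤ _
  omega

/-- A neighbour `w` of `v` closer to the root is `p v` or satisfies `p w = v`; in the second case
induction puts `v` closer than `w`, a contradiction. -/
lemma dist_lt (h : IsParentMap p r) {v : V} (hv : v ≠ r) :
    (parentGraph p).dist r (p v) < (parentGraph p).dist r v := by
  induction hd : (parentGraph p).dist r v using Nat.strong_induction_on generalizing v with
  | _ d ih =>
    obtain ⟨w, hw, hlt⟩ := h.connected.exists_adj_dist_lt hv
    obtain ⟨hne, rfl | hpw⟩ := hw
    · rwa [← hd]
    · have hwr : w ≠ r := by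
        rintro rfl
        exact hv (by rw [← hpw, h.map_root])
      have := ih _ (hd ▸ hlt) hwr rfl
      rw [hpw] at this
      exact absurd this hlt.le.not_gt

lemma preimages_eq (h : IsParentMap p r) (v : V) :
    {w | (parentGraph p).Adj v w ∧ (parentGraph p).dist r v < (parentGraph p).dist r w} =
      {w | w ≠ r ∧ p w = v} := by
  ext w
  constructor
  · rintro ⟨⟨hne, hvw | hwv⟩, hlt⟩
    · have hv : v ≠ r := by
        rintro rfl
        exact hne (by rw [← hvw, h.map_root])
      have := h.dist_lt hv
      rw [hvw] at this
      exact absurd this hlt.le.not_gt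
    · refine ⟨?_, hwv⟩
      rintro rfl
      exact hne (by rw [← hwv, h.map_root])
  · rintro ⟨hw, rfl⟩
    exact ⟨(h.adj hw).symm, h.dist_lt hw⟩

lemma eq_of_parentGraph_eq {q : V → V} (h : IsParentMap p r) (hq : IsParentMap q r)
    (heq : parentGraph p = parentGraph q) : p = q := by
  ext v
  by_cases hv : v = r
  · rw [hv, h.map_root, hq.map_root]
  · have hadj := h.adj hv
    have hlt := h.dist_lt hv
    rw [heq] at hadj hlt
    obtain ⟨hne, h1 | h1⟩ := hadj
    · exact h1.symm
    · have hpv : p v ≠ r := by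
        intro h'
        rw [h', hq.map_root] at h1
        exact hv h1.symm
      have := hq.dist_lt hpv
      rw [h1] at this
      exact absurd this hlt.le.not_gt

end IsParentMap

/-- Let `p` choose a neighbour closer to the root. A nonempty closed set would contain a node of
minimal distance, which `p` contradicts. The connected subgraph `parentGraph p` is all of `G` since
trees are minimal among connected graphs. -/
lemma SimpleGraph.IsTree.exists_parentGraph_eq [Fintype V] {G : SimpleGraph V} (hG : G.IsTree)
    (r : V) : ∃ p, IsParentMap p r ∧ parentGraph p = G := by
  classical
  have hex : ∀ v, ∃ w, (v = r → w = r) ∧ (v ≠ r → G.Adj v w ∧ G.dist r w < G.dist r v) := by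
    intro v
    by_cases hv : v = r
    · exact ⟨r, fun _ => rfl, fun h => absurd hv h⟩
    · obtain ⟨w, hw⟩ := hG.connected.exists_adj_dist_lt hv
      exact ⟨w, fun h => absurd h hv, fun _ => hw⟩
  choose p hp1 hp2 using hex
  have hp : IsParentMap p r := by
    refine ⟨hp1 r rfl, fun A hrA hA => ?_⟩
    by_contra hne
    obtain ⟨v, hv, hmin⟩ := A.exists_min_image (fun v => G.dist r v)
      (Finset.nonempty_iff_ne_empty.2 hne)
    have hvr : v ≠ r := fun h => hrA (h ▸ hv)
    exact (hmin (p v) (hA v hv)).not_gt (hp2 v hvr).2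
  refine ⟨p, hp, ?_⟩
  refine (SimpleGraph.isTree_iff_minimal_connected.1 hG).eq_of_le hp.connected ?_
  rintro v w ⟨hne, rfl | rfl⟩
  · exact (hp2 v fun h => hne (by rw [hp1 v h, h])).1
  · exact (hp2 w fun h => hne (by rw [hp1 w h, h])).1.symm

end Trees

lemma ncard_constrainedTrees (P : Set ℕ) (n : ℕ) :
    (constrainedTrees P n).ncard = ∑ r : Fin n, (parentMaps P Finset.univ {r}).card := by
  classical
  rw [← Finset.card_sigma, ← Set.ncard_coe_finset]
  symm
  refine Set.ncard_congr (fun t _ => (parentGraph t.2, t.1)) ?_ ?_ ?_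
  · rintro ⟨r, p⟩ ht
    simp only [Finset.coe_sigma, Set.mem_sigma_iff, Finset.mem_coe,
      mem_parentMaps_univ_singleton] at ht
    obtain ⟨-, hp, hP⟩ := ht
    refine ⟨hp.isTree, fun v => ?_⟩
    have := hP v
    rwa [← hp.preimages_eq v] at this
  · rintro ⟨r, p⟩ ⟨r', p'⟩ ht ht' heq
    simp only [Finset.coe_sigma, Set.mem_sigma_iff, Finset.mem_coe,
      mem_parentMaps_univ_singleton] at ht ht'
    simp only [Prod.mk.injEq] at heq
    obtain ⟨h1, rfl⟩ := heq
    rw [ht.2.1.eq_of_parentGraph_eq ht'.2.1 h1]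
  · rintro ⟨G, r⟩ ⟨hG, hP⟩
    obtain ⟨p, hp, rfl⟩ := SimpleGraph.IsTree.exists_parentGraph_eq hG r
    refine ⟨⟨r, p⟩, ?_, rfl⟩
    simp only [Finset.coe_sigma, Set.mem_sigma_iff, Finset.mem_coe,
      mem_parentMaps_univ_singleton]
    refine ⟨Finset.mem_coe.2 (Finset.mem_univ _), hp, fun v => ?_⟩
    rw [← hp.preimages_eq v]
    exact hP v

/-- The generating function of the constrained trees solves `T = X e_P(T)`. -/
lemma exists_treeSeries_eq {P : Set ℕ} (h0 : 0 ∈ P) :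
    ∃ W : PowerSeries ℂ, treeSeries P = PowerSeries.X * W ∧
      W = (truncExp ℂ P).subst (PowerSeries.X * W : PowerSeries ℂ) := by
  obtain ⟨W, hW⟩ := exists_eq_subst_X_mul (truncExp ℂ P) (by
    rw [← PowerSeries.coeff_zero_eq_constantCoeff_apply]
    simp [truncExp, h0])
  refine ⟨W, ?_, hW⟩
  ext n
  rw [treeSeries, PowerSeries.coeff_mk, ncard_constrainedTrees]
  push_cast
  simp only [card_parentMaps_eq h0 hW (Finset.subset_univ _), Finset.card_singleton, pow_one]
  rcases n with _ | n
  · simp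
  · rw [PowerSeries.coeff_succ_X_mul]
    -- The `n + 1` choices of the root turn the `n!` of each count into `(n + 1)!`.
    have hc : ∀ r : Fin (n + 1), (Finset.univ \ {r} : Finset (Fin (n + 1))).card = n := by
      intro r
      simp [Finset.card_sdiff]
    have hne : (n.factorial : ℂ) ≠ 0 := by exact_mod_cast n.factorial_ne_zero
    have hne' : (n : ℂ) + 1 ≠ 0 := by exact_mod_cast n.succ_ne_zero
    simp only [hc, Finset.sum_const, Finset.card_univ, Fintype.card_fin, nsmul_eq_mul,
      Nat.factorial_succ]
    push_cast
    field_simp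

lemma coeff_succ_treeSeries {P : Set ℕ} (h0 : 0 ∈ P) (n : ℕ) :
    PowerSeries.coeff (n + 1) (treeSeries P) = ∑ s ∈ Finset.range (n + 1),
      PowerSeries.coeff s (truncExp ℂ P) * PowerSeries.coeff n (treeSeries P ^ s) := by
  obtain ⟨W, hT, hW⟩ := exists_treeSeries_eq h0
  rw [hT, PowerSeries.coeff_succ_X_mul]
  conv_lhs => rw [hW]
  rw [coeff_subst_X_mul]
  refine Finset.sum_congr rfl fun s hs => ?_
  have : s ≤ n := by simpa [Nat.lt_succ_iff] using hs
  rw [mul_pow, PowerSeries.coeff_X_pow_mul', if_pos this]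

/-! ### Truncated exponentials as entire functions -/

section TruncExp

lemma mem_shiftDown {P : Set ℕ} {i m : ℕ} : m ∈ shiftDown P i ↔ m + i ∈ P := by
  constructor
  · rintro ⟨n, hn, h⟩
    obtain rfl : n = m + i := by omega
    exact hn
  · intro h
    exact ⟨m + i, h, by push_cast; ring⟩

lemma shiftDown_shiftDown (P : Set ℕ) (i j : ℕ) :
    shiftDown (shiftDown P i) j = shiftDown P (j + i) := by
  ext m
  simp only [mem_shiftDown, add_assoc]

lemma coeff_truncExp_of_mem {𝕜 : Type*} [NormedField 𝕜] {P : Set ℕ} {n : ℕ} (h : n ∈ P) :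
    PowerSeries.coeff n (truncExp 𝕜 P) = (n.factorial : 𝕜)⁻¹ := by
  simp [truncExp, h]

lemma coeff_truncExp_of_notMem {𝕜 : Type*} [NormedField 𝕜] {P : Set ℕ} {n : ℕ} (h : n ∉ P) :
    PowerSeries.coeff n (truncExp 𝕜 P) = 0 := by
  simp [truncExp, h]

lemma succ_mul_coeff_truncExp {𝕜 : Type*} [RCLike 𝕜] (P : Set ℕ) (n : ℕ) :
    ((n + 1 : ℕ) : 𝕜) * PowerSeries.coeff (n + 1) (truncExp 𝕜 P) =
      PowerSeries.coeff n (truncExp 𝕜 (shiftDown P 1)) := by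
  by_cases h : n + 1 ∈ P
  · rw [coeff_truncExp_of_mem h, coeff_truncExp_of_mem (mem_shiftDown.2 h), Nat.factorial_succ]
    have h1 : ((n + 1 : ℕ) : 𝕜) ≠ 0 := Nat.cast_ne_zero.2 n.succ_ne_zero
    rw [Nat.cast_mul, mul_inv, mul_inv_cancel_left₀ h1]
  · rw [coeff_truncExp_of_notMem h, coeff_truncExp_of_notMem (mem_shiftDown.not.2 h), mul_zero]

lemma coeff_truncExp_nonneg (P : Set ℕ) (n : ℕ) :
    0 ≤ PowerSeries.coeff n (truncExp ℝ P) := by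
  by_cases h : n ∈ P
  · rw [coeff_truncExp_of_mem h]
    positivity
  · rw [coeff_truncExp_of_notMem h]

lemma coeff_truncExp_pos {P : Set ℕ} {n : ℕ} (h : n ∈ P) :
    0 < PowerSeries.coeff n (truncExp ℝ P) := by
  rw [coeff_truncExp_of_mem h]
  positivity

lemma norm_coeff_truncExp {𝕜 : Type*} [RCLike 𝕜] (P : Set ℕ) (n : ℕ) :
    ‖PowerSeries.coeff n (truncExp 𝕜 P)‖ = PowerSeries.coeff n (truncExp ℝ P) := by
  by_cases h : n ∈ P
  · simp [coeff_truncExp_of_mem h]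
  · simp [coeff_truncExp_of_notMem h]

lemma ofReal_coeff_truncExp (P : Set ℕ) (n : ℕ) :
    ((PowerSeries.coeff n (truncExp ℝ P) : ℝ) : ℂ) = PowerSeries.coeff n (truncExp ℂ P) := by
  by_cases h : n ∈ P
  · simp [coeff_truncExp_of_mem h]
  · simp [coeff_truncExp_of_notMem h]

lemma coeff_truncExp_le (P : Set ℕ) (n : ℕ) :
    PowerSeries.coeff n (truncExp ℝ P) ≤ (n.factorial : ℝ)⁻¹ := by
  by_cases h : n ∈ P
  · rw [coeff_truncExp_of_mem h]
  · rw [coeff_truncExp_of_notMem h]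
    positivity

lemma norm_truncExp_term {𝕜 : Type*} [RCLike 𝕜] (P : Set ℕ) (x : 𝕜) (n : ℕ) :
    ‖PowerSeries.coeff n (truncExp 𝕜 P) * x ^ n‖ =
      PowerSeries.coeff n (truncExp ℝ P) * ‖x‖ ^ n := by
  rw [norm_mul, norm_pow, norm_coeff_truncExp]

lemma summable_norm_truncExp {𝕜 : Type*} [RCLike 𝕜] (P : Set ℕ) (x : 𝕜) :
    Summable fun n => ‖PowerSeries.coeff n (truncExp 𝕜 P) * x ^ n‖ := by
  refine Summable.of_nonneg_of_le (fun n => norm_nonneg _) (fun n => ?_)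
    (Real.summable_pow_div_factorial ‖x‖)
  rw [norm_truncExp_term, div_eq_inv_mul]
  exact mul_le_mul_of_nonneg_right (coeff_truncExp_le P n) (by positivity)

lemma hasSum_truncExp {𝕜 : Type*} [RCLike 𝕜] (P : Set ℕ) (x : 𝕜) :
    HasSum (fun n => PowerSeries.coeff n (truncExp 𝕜 P) * x ^ n)
      (seriesEval (truncExp 𝕜 P) x) :=
  (summable_norm_truncExp P x).of_norm.hasSum

lemma ofReal_seriesEval_truncExp (P : Set ℕ) (x : ℝ) :
    ((seriesEval (truncExp ℝ P) x : ℝ) : ℂ) = seriesEval (truncExp ℂ P) (x : ℂ) := by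
  rw [seriesEval, seriesEval, Complex.ofReal_tsum]
  simp only [Complex.ofReal_mul, Complex.ofReal_pow, ofReal_coeff_truncExp]

lemma norm_seriesEval_truncExp_le (P : Set ℕ) (z : ℂ) :
    ‖seriesEval (truncExp ℂ P) z‖ ≤ seriesEval (truncExp ℝ P) ‖z‖ := by
  refine (norm_tsum_le_tsum_norm (summable_norm_truncExp P z)).trans_eq ?_
  simp only [norm_truncExp_term, seriesEval]

lemma hasDerivAt_truncExp {𝕜 : Type*} [RCLike 𝕜] (P : Set ℕ) (x : 𝕜) :
    HasDerivAt (seriesEval (truncExp 𝕜 P)) (seriesEval (truncExp 𝕜 (shiftDown P 1)) x) x := by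
  -- Termwise differentiation on a ball containing `x`, dominated by the series of derivatives at
  -- the radius `r`.
  set r := ‖x‖ + 1 with hr
  have hr0 : 0 ≤ r := by positivity
  have hx : x ∈ Metric.ball (0 : 𝕜) r := by simp [hr]
  have hsum : Summable fun n : ℕ => (n : ℝ) * PowerSeries.coeff n (truncExp ℝ P) * r ^ (n - 1) := by
    rw [← summable_nat_add_iff 1]
    refine (summable_norm_truncExp (shiftDown P 1) r).congr fun n => ?_
    rw [norm_truncExp_term, Real.norm_of_nonneg hr0, ← succ_mul_coeff_truncExp,
      Nat.add_sub_cancel]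
  have h := hasDerivAt_tsum_of_isPreconnected hsum Metric.isOpen_ball
    (convex_ball (0 : 𝕜) r).isPreconnected
    (g := fun n y => PowerSeries.coeff n (truncExp 𝕜 P) * y ^ n)
    (g' := fun n y => PowerSeries.coeff n (truncExp 𝕜 P) * ((n : 𝕜) * y ^ (n - 1)))
    (fun n y _ => (hasDerivAt_pow n y).const_mul _) (fun n y hy => ?_) hx
    (summable_norm_truncExp P x).of_norm hx
  · have h1 : Summable fun n : ℕ =>
        PowerSeries.coeff n (truncExp 𝕜 P) * ((n : 𝕜) * x ^ (n - 1)) := by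
      rw [← summable_nat_add_iff 1]
      refine (summable_norm_truncExp (shiftDown P 1) x).of_norm.congr fun n => ?_
      rw [← succ_mul_coeff_truncExp, Nat.add_sub_cancel]
      ring
    have h2 : seriesEval (truncExp 𝕜 (shiftDown P 1)) x =
        ∑' n : ℕ, PowerSeries.coeff n (truncExp 𝕜 P) * ((n : 𝕜) * x ^ (n - 1)) := by
      rw [h1.tsum_eq_zero_add, seriesEval]
      simp only [Nat.cast_zero, zero_mul, mul_zero, zero_add]
      refine tsum_congr fun n => ?_
      rw [← succ_mul_coeff_truncExp, Nat.add_sub_cancel]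
      ring
    rw [h2]
    exact h
  · rw [norm_mul, norm_mul, norm_pow, norm_coeff_truncExp, RCLike.norm_natCast]
    have hy' : ‖y‖ ≤ r := by simpa using (Metric.mem_ball.1 hy).le
    calc _ = (n : ℝ) * PowerSeries.coeff n (truncExp ℝ P) * ‖y‖ ^ (n - 1) := by ring
      _ ≤ _ := by
        have := coeff_truncExp_nonneg P n
        gcongr

lemma deriv_truncExp {𝕜 : Type*} [RCLike 𝕜] (P : Set ℕ) :
    deriv (seriesEval (truncExp 𝕜 P)) = seriesEval (truncExp 𝕜 (shiftDown P 1)) :=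
  funext fun x => (hasDerivAt_truncExp P x).deriv

lemma differentiable_truncExp {𝕜 : Type*} [RCLike 𝕜] (P : Set ℕ) :
    Differentiable 𝕜 (seriesEval (truncExp 𝕜 P)) :=
  fun x => (hasDerivAt_truncExp P x).differentiableAt

lemma seriesEval_truncExp_zero {𝕜 : Type*} [RCLike 𝕜] {P : Set ℕ} (h0 : 0 ∈ P) :
    seriesEval (truncExp 𝕜 P) 0 = 1 := by
  rw [seriesEval, tsum_eq_single 0 (fun n hn => by simp [hn])]
  simp [coeff_truncExp_of_mem h0]

lemma le_seriesEval_truncExp (P : Set ℕ) (n : ℕ) {x : ℝ} (hx : 0 ≤ x) :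
    PowerSeries.coeff n (truncExp ℝ P) * x ^ n ≤ seriesEval (truncExp ℝ P) x :=
  le_hasSum (hasSum_truncExp P x) n fun m _ =>
    mul_nonneg (coeff_truncExp_nonneg P m) (pow_nonneg hx m)

lemma seriesEval_truncExp_mono (P : Set ℕ) {x y : ℝ} (hx : 0 ≤ x) (hxy : x ≤ y) :
    seriesEval (truncExp ℝ P) x ≤ seriesEval (truncExp ℝ P) y :=
  hasSum_le (fun n => mul_le_mul_of_nonneg_left (pow_le_pow_left₀ hx hxy n)
    (coeff_truncExp_nonneg P n)) (hasSum_truncExp P x) (hasSum_truncExp P y)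

lemma seriesEval_truncExp_strictMono {P : Set ℕ} {n : ℕ} (hn : n ∈ P) (hn0 : n ≠ 0) {x y : ℝ}
    (hx : 0 ≤ x) (hxy : x < y) :
    seriesEval (truncExp ℝ P) x < seriesEval (truncExp ℝ P) y :=
  hasSum_lt (i := n) (fun n => mul_le_mul_of_nonneg_left (pow_le_pow_left₀ hx hxy.le n)
    (coeff_truncExp_nonneg P n)) (mul_lt_mul_of_pos_left (pow_lt_pow_left₀ hxy hx hn0)
    (coeff_truncExp_pos hn)) (hasSum_truncExp P x) (hasSum_truncExp P y)

lemma seriesEval_truncExp_pos {P : Set ℕ} {n : ℕ} (hn : n ∈ P) {x : ℝ} (hx : 0 < x) :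
    0 < seriesEval (truncExp ℝ P) x :=
  (mul_pos (coeff_truncExp_pos hn) (pow_pos hx n)).trans_le (le_seriesEval_truncExp P n hx.le)

lemma one_le_seriesEval_truncExp {P : Set ℕ} (h0 : 0 ∈ P) {x : ℝ} (hx : 0 ≤ x) :
    1 ≤ seriesEval (truncExp ℝ P) x := by
  simpa [coeff_truncExp_of_mem h0] using le_seriesEval_truncExp P 0 hx

end TruncExp

/-! ### Radius of convergence -/

section Radius

lemma norm_ofScalars_coeff (f : PowerSeries ℂ) (n : ℕ) :
    ‖FormalMultilinearSeries.ofScalars ℂ (fun n : ℕ => PowerSeries.coeff n f) n‖ =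
      ‖PowerSeries.coeff n f‖ :=
  FormalMultilinearSeries.ofScalars_norm ℂ _ n

lemma le_seriesRadius {f : PowerSeries ℂ} {r : ℝ} (hr : 0 ≤ r)
    (h : Summable fun n => ‖PowerSeries.coeff n f‖ * r ^ n) :
    ENNReal.ofReal r ≤ seriesRadius f := by
  lift r to NNReal using hr
  rw [ENNReal.ofReal_coe_nnreal]
  refine FormalMultilinearSeries.le_radius_of_summable _ ?_
  simpa only [norm_ofScalars_coeff] using h

lemma seriesRadius_truncExp (P : Set ℕ) : seriesRadius (truncExp ℂ P) = ⊤ := by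
  refine FormalMultilinearSeries.radius_eq_top_of_summable_norm _ fun r => ?_
  simp only [norm_ofScalars_coeff]
  refine (summable_norm_truncExp P (r : ℝ)).congr fun n => ?_
  rw [norm_truncExp_term, norm_coeff_truncExp,
    Real.norm_of_nonneg r.coe_nonneg]

lemma hasFPowerSeriesOnBall_seriesEval {f : PowerSeries ℂ} (h : 0 < seriesRadius f) :
    HasFPowerSeriesOnBall (seriesEval f)
      (FormalMultilinearSeries.ofScalars ℂ (fun n : ℕ => PowerSeries.coeff n f)) 0
      (seriesRadius f) := by
  have h1 := FormalMultilinearSeries.hasFPowerSeriesOnBall _ h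
  have h2 : seriesEval f = (FormalMultilinearSeries.ofScalars ℂ
      (fun n : ℕ => PowerSeries.coeff n f)).sum := by
    funext x
    simp [seriesEval, FormalMultilinearSeries.sum, mul_comm]
  rw [h2]
  exact h1

end Radius

/-! ### The characteristic root -/

section CharacteristicRoot

variable {P : Set ℕ}

/-- The function `e_P(x) - x e_P'(x)`. -/
def charFun (P : Set ℕ) (x : ℝ) : ℝ :=
  seriesEval (truncExp ℝ P) x - x * seriesEval (truncExp ℝ (shiftDown P 1)) x

lemma isCharacteristicRoot_iff {τ : ℝ} : IsCharacteristicRoot P τ ↔ 0 < τ ∧ charFun P τ = 0 := by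
  rw [IsCharacteristicRoot, deriv_truncExp, charFun]

lemma hasDerivAt_charFun (P : Set ℕ) (x : ℝ) :
    HasDerivAt (charFun P) (-(x * seriesEval (truncExp ℝ (shiftDown P 2)) x)) x := by
  have h1 := hasDerivAt_truncExp P x
  have h2 := hasDerivAt_truncExp (shiftDown P 1) x
  rw [shiftDown_shiftDown] at h2
  refine (h1.fun_sub ((hasDerivAt_id' x).fun_mul h2)).congr_deriv ?_
  ring

lemma charFun_zero (h0 : 0 ∈ P) : charFun P 0 = 1 := by
  simp [charFun, seriesEval_truncExp_zero h0]

lemma strictAntiOn_charFun (h2 : (shiftDown P 2).Nonempty) :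
    StrictAntiOn (charFun P) (Set.Ici 0) := by
  obtain ⟨m, hm⟩ := h2
  refine strictAntiOn_of_deriv_neg (convex_Ici 0)
    (fun x _ => (hasDerivAt_charFun P x).continuousAt.continuousWithinAt) fun x hx => ?_
  rw [interior_Ici, Set.mem_Ioi] at hx
  rw [(hasDerivAt_charFun P x).deriv, neg_lt_zero]
  exact mul_pos hx (seriesEval_truncExp_pos hm hx)

/-- On `[1, ∞)` the derivative `-x e_{P-2}(x)` is at most `-c` with `c = e_{P-2}(1) > 0`, so the
function decreases at least linearly. -/
lemma exists_charFun_nonpos (h0 : 0 ∈ P) (h2 : (shiftDown P 2).Nonempty) :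
    ∃ x, 0 < x ∧ charFun P x ≤ 0 := by
  have hanti := strictAntiOn_charFun h2
  obtain ⟨m, hm⟩ := h2
  set c := seriesEval (truncExp ℝ (shiftDown P 2)) 1 with hc
  have hc0 : 0 < c := seriesEval_truncExp_pos hm one_pos
  have hd : ∀ x, HasDerivAt (fun x => charFun P x + c * x)
      (-(x * seriesEval (truncExp ℝ (shiftDown P 2)) x) + c) x := fun x => by
    simpa using (hasDerivAt_charFun P x).fun_add ((hasDerivAt_id' x).const_mul c)
  have h1 : AntitoneOn (fun x => charFun P x + c * x) (Set.Ici 1) := by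
    refine antitoneOn_of_deriv_nonpos (convex_Ici 1)
      (fun x _ => (hd x).continuousAt.continuousWithinAt)
      (fun x _ => (hd x).differentiableAt.differentiableWithinAt) fun x hx => ?_
    rw [interior_Ici, Set.mem_Ioi] at hx
    rw [(hd x).deriv]
    have h3 := seriesEval_truncExp_mono (shiftDown P 2) zero_le_one hx.le
    rw [← hc] at h3
    nlinarith
  -- The value at `1` is less than `1`, and a further step of length `1 / c` lowers it by at least
  -- `1`.
  refine ⟨1 + 1 / c, by positivity, ?_⟩
  have h4 := h1 (Set.mem_Ici.2 le_rfl) (Set.mem_Ici.2 (by simp; positivity) : 1 + 1 / c ∈ _)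
    (by simp; positivity)
  have h5 := hanti (Set.mem_Ici.2 le_rfl) (Set.mem_Ici.2 zero_le_one) one_pos
  rw [charFun_zero h0] at h5
  have h6 : c * (1 + 1 / c) = c + 1 := by field_simp
  simp only [h6] at h4
  linarith

lemma existsUnique_isCharacteristicRoot (h0 : 0 ∈ P) (h2 : (shiftDown P 2).Nonempty) :
    ∃! τ : ℝ, IsCharacteristicRoot P τ := by
  obtain ⟨x, hx, hFx⟩ := exists_charFun_nonpos h0 h2
  obtain ⟨τ, hτ, hFτ⟩ := intermediate_value_Icc' hx.le
    (fun y _ => (hasDerivAt_charFun P y).continuousAt.continuousWithinAt)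
    (show (0 : ℝ) ∈ Set.Icc (charFun P x) (charFun P 0) from
      ⟨hFx, by rw [charFun_zero h0]; exact zero_le_one⟩)
  refine ⟨τ, isCharacteristicRoot_iff.2 ⟨lt_of_le_of_ne hτ.1 ?_, hFτ⟩, fun σ hσ => ?_⟩
  · rintro rfl
    rw [charFun_zero h0] at hFτ
    exact one_ne_zero hFτ
  · replace hσ := isCharacteristicRoot_iff.1 hσ
    exact (strictAntiOn_charFun h2).injOn (Set.mem_Ici.2 hσ.1.le) (Set.mem_Ici.2 hτ.1)
      (hσ.2.trans hFτ.symm)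

lemma isCharacteristicRoot_tauP (h0 : 0 ∈ P) (h2 : (shiftDown P 2).Nonempty) :
    IsCharacteristicRoot P (tauP P) :=
  Classical.epsilon_spec (existsUnique_isCharacteristicRoot h0 h2).exists

lemma tauP_pos (h0 : 0 ∈ P) (h2 : (shiftDown P 2).Nonempty) : 0 < tauP P :=
  (isCharacteristicRoot_tauP h0 h2).1

lemma charFun_tauP (h0 : 0 ∈ P) (h2 : (shiftDown P 2).Nonempty) : charFun P (tauP P) = 0 :=
  (isCharacteristicRoot_iff.1 (isCharacteristicRoot_tauP h0 h2)).2

lemma seriesEval_tauP_pos (h0 : 0 ∈ P) (h2 : (shiftDown P 2).Nonempty) :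
    0 < seriesEval (truncExp ℝ P) (tauP P) :=
  seriesEval_truncExp_pos h0 (tauP_pos h0 h2)

lemma rhoP_pos (h0 : 0 ∈ P) (h2 : (shiftDown P 2).Nonempty) : 0 < rhoP P :=
  div_pos (tauP_pos h0 h2) (seriesEval_tauP_pos h0 h2)

lemma rhoP_mul (h0 : 0 ∈ P) (h2 : (shiftDown P 2).Nonempty) :
    rhoP P * seriesEval (truncExp ℝ P) (tauP P) = tauP P :=
  div_mul_cancel₀ _ (seriesEval_tauP_pos h0 h2).ne'

lemma rhoP_mul_deriv (h0 : 0 ∈ P) (h2 : (shiftDown P 2).Nonempty) :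
    rhoP P * seriesEval (truncExp ℝ (shiftDown P 1)) (tauP P) = 1 := by
  have h := charFun_tauP h0 h2
  have hpos := seriesEval_tauP_pos h0 h2
  rw [charFun, sub_eq_zero] at h
  rw [rhoP, div_mul_eq_mul_div, ← h, div_self hpos.ne']

/-- The derivative of `x / e_P(x)` is `charFun P x / e_P(x) ^ 2`, which is positive before `τ_P`. -/
lemma strictMonoOn_div_truncExp (h0 : 0 ∈ P) (h2 : (shiftDown P 2).Nonempty) :
    StrictMonoOn (fun x : ℝ => x / seriesEval (truncExp ℝ P) x) (Set.Icc 0 (tauP P)) := by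
  have hpos : ∀ x, 0 ≤ x → seriesEval (truncExp ℝ P) x ≠ 0 := fun x hx =>
    (one_pos.trans_le (one_le_seriesEval_truncExp h0 hx)).ne'
  have hd : ∀ x, 0 ≤ x → HasDerivAt (fun x : ℝ => x / seriesEval (truncExp ℝ P) x)
      (charFun P x / seriesEval (truncExp ℝ P) x ^ 2) x := fun x hx => by
    refine ((hasDerivAt_id' x).fun_div (hasDerivAt_truncExp P x) (hpos x hx)).congr_deriv ?_
    rw [charFun, one_mul]
  refine strictMonoOn_of_deriv_pos (convex_Icc _ _)
    (fun x hx => (hd x hx.1).continuousAt.continuousWithinAt) fun x hx => ?_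
  rw [interior_Icc] at hx
  rw [(hd x hx.1.le).deriv]
  have := strictAntiOn_charFun h2 (Set.mem_Ici.2 hx.1.le)
    (Set.mem_Ici.2 (tauP_pos h0 h2).le) hx.2
  rw [charFun_tauP h0 h2] at this
  exact div_pos this (pow_pos ((hpos x hx.1.le).symm.lt_of_le
    (zero_le_one.trans (one_le_seriesEval_truncExp h0 hx.1.le))) 2)

lemma hSchema_truncExp (h0 : 0 ∈ P) (h2 : (shiftDown P 2).Nonempty) : HSchema (truncExp ℂ P) where
  analytic_at_zero := by
    rw [seriesRadius_truncExp]
    exact ENNReal.zero_lt_top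
  eval_zero_ne := by
    rw [seriesEval_truncExp_zero h0]
    exact one_ne_zero
  not_affine := by
    rintro ⟨a, b, hab⟩
    obtain ⟨m, hm⟩ := h2
    have h := congrArg (PowerSeries.coeff (m + 2)) hab
    rw [coeff_truncExp_of_mem (mem_shiftDown.1 hm), map_add, PowerSeries.coeff_C,
      if_neg (by omega), PowerSeries.coeff_C_mul, PowerSeries.coeff_X, if_neg (by omega)] at h
    simp [Nat.factorial_ne_zero] at h
  coeff_nonneg n := ⟨_, coeff_truncExp_nonneg P n, (ofReal_coeff_truncExp P n).symm⟩
  existsUnique_root := by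
    have hiff : ∀ τ : ℝ, (0 < τ ∧ ENNReal.ofReal τ < seriesRadius (truncExp ℂ P) ∧
        seriesEval (truncExp ℂ P) (τ : ℂ) - (τ : ℂ) * deriv (seriesEval (truncExp ℂ P)) (τ : ℂ) = 0)
        ↔ IsCharacteristicRoot P τ := fun τ => by
      rw [seriesRadius_truncExp, deriv_truncExp, isCharacteristicRoot_iff,
        ← ofReal_seriesEval_truncExp, ← ofReal_seriesEval_truncExp, charFun]
      norm_cast
      simp [ENNReal.ofReal_lt_top]
    simp only [hiff]
    exact existsUnique_isCharacteristicRoot h0 h2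

end CharacteristicRoot

/-! ### Products of absolutely convergent power series -/

section SeriesEval

/-- The triangle of index pairs lies inside the square. -/
lemma sum_range_sum_antidiagonal_le {a b : ℕ → ℝ} (ha : ∀ n, 0 ≤ a n) (hb : ∀ n, 0 ≤ b n)
    (N : ℕ) : ∑ n ∈ Finset.range N, ∑ kl ∈ Finset.HasAntidiagonal.antidiagonal n, a kl.1 * b kl.2 ≤
      (∑ n ∈ Finset.range N, a n) * ∑ n ∈ Finset.range N, b n := by
  rw [Finset.sum_mul_sum, ← Finset.sum_product', ← Finset.sum_biUnion]
  · refine Finset.sum_le_sum_of_subset_of_nonneg (fun kl hkl => ?_)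
      fun kl _ _ => mul_nonneg (ha _) (hb _)
    simp only [Finset.mem_biUnion, Finset.mem_range, Finset.HasAntidiagonal.mem_antidiagonal,
      Finset.mem_product] at hkl ⊢
    omega
  · intro m _ n _ hmn
    refine Finset.disjoint_left.2 fun kl hm hn => hmn ?_
    rw [Finset.HasAntidiagonal.mem_antidiagonal] at hm hn
    omega

/-- The partial sums of the series of absolute values. -/
def partialNorm (f : PowerSeries ℂ) (r : ℝ) (N : ℕ) : ℝ :=
  ∑ n ∈ Finset.range N, ‖PowerSeries.coeff n f‖ * r ^ n

lemma partialNorm_nonneg (f : PowerSeries ℂ) {r : ℝ} (hr : 0 ≤ r) (N : ℕ) :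
    0 ≤ partialNorm f r N :=
  Finset.sum_nonneg fun n _ => by positivity

lemma partialNorm_mul_le (f g : PowerSeries ℂ) {r : ℝ} (hr : 0 ≤ r) (N : ℕ) :
    partialNorm (f * g) r N ≤ partialNorm f r N * partialNorm g r N := by
  refine le_trans (Finset.sum_le_sum fun n _ => ?_) (sum_range_sum_antidiagonal_le
    (a := fun n => ‖PowerSeries.coeff n f‖ * r ^ n) (b := fun n => ‖PowerSeries.coeff n g‖ * r ^ n)
    (fun n => by positivity) (fun n => by positivity) N)
  rw [PowerSeries.coeff_mul]
  refine (mul_le_mul_of_nonneg_right (norm_sum_le _ _) (pow_nonneg hr n)).trans_eq ?_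
  rw [Finset.sum_mul]
  refine Finset.sum_congr rfl fun kl hkl => ?_
  rw [norm_mul, ← Finset.HasAntidiagonal.mem_antidiagonal.1 hkl, pow_add]
  ring

lemma partialNorm_one_le (r : ℝ) (N : ℕ) : partialNorm 1 r N ≤ 1 := by
  rcases N with _ | N
  · simp [partialNorm]
  · rw [partialNorm, Finset.sum_eq_single 0 (fun n _ hn => by simp [PowerSeries.coeff_one, hn])
      (by simp)]
    simp

lemma partialNorm_pow_le (f : PowerSeries ℂ) {r : ℝ} (hr : 0 ≤ r) (N s : ℕ) :
    partialNorm (f ^ s) r N ≤ partialNorm f r N ^ s := by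
  induction s with
  | zero => simpa using partialNorm_one_le r N
  | succ s ih =>
    rw [pow_succ, pow_succ]
    exact (partialNorm_mul_le _ _ hr N).trans
      (mul_le_mul_of_nonneg_right ih (partialNorm_nonneg f hr N))

lemma summable_of_partialNorm_le {f : PowerSeries ℂ} {r c : ℝ} (hr : 0 ≤ r)
    (h : ∀ N, partialNorm f r N ≤ c) :
    Summable (fun n => ‖PowerSeries.coeff n f‖ * r ^ n) ∧
      ∑' n, ‖PowerSeries.coeff n f‖ * r ^ n ≤ c :=
  ⟨summable_of_sum_range_le (fun n => by positivity) h,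
    Real.tsum_le_of_sum_range_le (fun n => by positivity) h⟩

lemma seriesEval_mul {f g : PowerSeries ℂ} {z : ℂ}
    (hf : Summable fun n => ‖PowerSeries.coeff n f * z ^ n‖)
    (hg : Summable fun n => ‖PowerSeries.coeff n g * z ^ n‖) :
    (Summable fun n => ‖PowerSeries.coeff n (f * g) * z ^ n‖) ∧
      seriesEval (f * g) z = seriesEval f z * seriesEval g z := by
  have key : ∀ n, PowerSeries.coeff n (f * g) * z ^ n = ∑ kl ∈ Finset.HasAntidiagonal.antidiagonal n,
      (PowerSeries.coeff kl.1 f * z ^ kl.1) * (PowerSeries.coeff kl.2 g * z ^ kl.2) := fun n => by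
    rw [PowerSeries.coeff_mul, Finset.sum_mul]
    refine Finset.sum_congr rfl fun kl hkl => ?_
    rw [← Finset.HasAntidiagonal.mem_antidiagonal.1 hkl, pow_add]
    ring
  constructor
  · simpa only [key] using summable_norm_sum_mul_antidiagonal_of_summable_norm hf hg
  · rw [seriesEval, seriesEval, seriesEval,
      tsum_mul_tsum_eq_tsum_sum_antidiagonal_of_summable_norm hf hg]
    exact tsum_congr key

lemma seriesEval_pow {f : PowerSeries ℂ} {z : ℂ}
    (hf : Summable fun n => ‖PowerSeries.coeff n f * z ^ n‖) (s : ℕ) :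
    (Summable fun n => ‖PowerSeries.coeff n (f ^ s) * z ^ n‖) ∧
      seriesEval (f ^ s) z = seriesEval f z ^ s := by
  induction s with
  | zero =>
    have h1 : ∀ n, n ∉ ({0} : Finset ℕ) →
        PowerSeries.coeff n (1 : PowerSeries ℂ) * z ^ n = 0 := fun n hn => by
      rw [Finset.mem_singleton] at hn
      simp [PowerSeries.coeff_one, hn]
    rw [pow_zero, pow_zero]
    refine ⟨summable_of_ne_finset_zero (s := {0}) fun n hn => by rw [h1 n hn, norm_zero], ?_⟩
    rw [seriesEval, tsum_eq_sum h1]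
    simp
  | succ s ih =>
    rw [pow_succ, pow_succ, ← ih.2]
    exact seriesEval_mul ih.1 hf

lemma summable_prod_mul_of_tsum_le {a c : ℕ → ℝ} {b : ℕ → ℕ → ℝ} (ha : ∀ s, 0 ≤ a s)
    (hb : ∀ s n, 0 ≤ b s n) (hsum : ∀ s, Summable (b s)) (hle : ∀ s, ∑' n, b s n ≤ c s)
    (hac : Summable fun s => a s * c s) : Summable fun p : ℕ × ℕ => a p.1 * b p.1 p.2 := by
  rw [summable_prod_of_nonneg (fun p => mul_nonneg (ha _) (hb _ _))]
  have h1 : ∀ s, Summable fun n => a s * b s n := fun s => (hsum s).mul_left (a s)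
  have h2 : Summable fun s => ∑' n, a s * b s n := by
    refine Summable.of_nonneg_of_le (fun s => tsum_nonneg fun n => mul_nonneg (ha s) (hb s n))
      (fun s => ?_) hac
    rw [tsum_mul_left]
    exact mul_le_mul_of_nonneg_left (hle s) (ha s)
  exact ⟨h1, h2⟩

lemma tsum_sum_range_mul {a v : ℕ → ℂ} {g : ℕ → ℕ → ℂ}
    (hF : Summable fun p : ℕ × ℕ => a p.1 * g p.1 p.2) (hv : ∀ s, ∑' n, g s n = v s)
    (hg : ∀ s n, n < s → g s n = 0) :
    ∑' n, ∑ s ∈ Finset.range (n + 1), a s * g s n = ∑' s, a s * v s := by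
  have hn : ∀ n, ∑ s ∈ Finset.range (n + 1), a s * g s n = ∑' s, a s * g s n := fun n => by
    rw [tsum_eq_sum]
    intro s hs
    rw [hg s n (by simpa using hs), mul_zero]
  rw [tsum_congr hn, hF.tsum_comm]
  exact tsum_congr fun s => by rw [tsum_mul_left, hv]

end SeriesEval

/-! ### The tree series on the closed disc -/

section TreeSeries

variable {P : Set ℕ}

lemma coeff_zero_treeSeries (h0 : 0 ∈ P) : PowerSeries.coeff 0 (treeSeries P) = 0 := by
  obtain ⟨W, hT, -⟩ := exists_treeSeries_eq h0
  simp [hT]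

lemma coeff_treeSeries_pow_of_lt (h0 : 0 ∈ P) {n s : ℕ} (h : n < s) :
    PowerSeries.coeff n (treeSeries P ^ s) = 0 := by
  obtain ⟨W, hT, -⟩ := exists_treeSeries_eq h0
  rw [hT, mul_pow, PowerSeries.coeff_X_pow_mul', if_neg (by omega)]

/-- A truncated form of `T = z e_P(T)`: the shift by `X` makes the first `N + 1` coefficients of `T`
depend only on the first `N`. No convergence is assumed. -/
lemma partialNorm_treeSeries_succ_le (h0 : 0 ∈ P) {r : ℝ} (hr : 0 ≤ r) (N : ℕ) :
    partialNorm (treeSeries P) r (N + 1) ≤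
      r * seriesEval (truncExp ℝ P) (partialNorm (treeSeries P) r N) := by
  have hterm : ∀ n ∈ Finset.range N, ‖PowerSeries.coeff (n + 1) (treeSeries P)‖ * r ^ (n + 1) ≤
      ∑ s ∈ Finset.range N, r * (PowerSeries.coeff s (truncExp ℝ P) *
        (‖PowerSeries.coeff n (treeSeries P ^ s)‖ * r ^ n)) := by
    intro n hn
    rw [Finset.mem_range] at hn
    rw [coeff_succ_treeSeries h0]
    calc _ ≤ (∑ s ∈ Finset.range (n + 1), PowerSeries.coeff s (truncExp ℝ P) *
            ‖PowerSeries.coeff n (treeSeries P ^ s)‖) * r ^ (n + 1) := by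
          refine mul_le_mul_of_nonneg_right ((norm_sum_le _ _).trans_eq ?_) (by positivity)
          exact Finset.sum_congr rfl fun s _ => by rw [norm_mul, norm_coeff_truncExp]
      _ = ∑ s ∈ Finset.range (n + 1), r * (PowerSeries.coeff s (truncExp ℝ P) *
            (‖PowerSeries.coeff n (treeSeries P ^ s)‖ * r ^ n)) := by
          rw [Finset.sum_mul]
          exact Finset.sum_congr rfl fun s _ => by ring
      _ ≤ _ := by
          refine Finset.sum_le_sum_of_subset_of_nonneg
            (Finset.range_subset_range.2 (by omega)) fun s _ _ => ?_
          have := coeff_truncExp_nonneg P s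
          positivity
  rw [partialNorm, Finset.sum_range_succ', coeff_zero_treeSeries h0, norm_zero, zero_mul, add_zero]
  refine (Finset.sum_le_sum hterm).trans ?_
  rw [Finset.sum_comm]
  simp only [← Finset.mul_sum]
  refine mul_le_mul_of_nonneg_left ?_ hr
  have hnn := partialNorm_nonneg (treeSeries P) hr N
  refine le_trans (Finset.sum_le_sum fun s _ => mul_le_mul_of_nonneg_left
    (partialNorm_pow_le (treeSeries P) hr N s) (coeff_truncExp_nonneg P s)) ?_
  exact sum_le_hasSum _ (fun s _ => mul_nonneg (coeff_truncExp_nonneg P s) (pow_nonneg hnn s))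
    (hasSum_truncExp P _)

lemma norm_treeSeries_term_le {z : ℂ} (hz : ‖z‖ ≤ rhoP P) (n : ℕ) :
    ‖PowerSeries.coeff n (treeSeries P) * z ^ n‖ ≤
      ‖PowerSeries.coeff n (treeSeries P)‖ * rhoP P ^ n := by
  rw [norm_mul, norm_pow]
  gcongr

variable (h0 : 0 ∈ P) (h2 : (shiftDown P 2).Nonempty)
include h0 h2

/-- Since `τ` is a fixed point of the increasing map `x ↦ ρ e_P(x)`, the bound passes from `N` to `N
+ 1`. It yields absolute convergence on the closed disc. -/
lemma partialNorm_treeSeries_le (N : ℕ) : partialNorm (treeSeries P) (rhoP P) N ≤ tauP P := by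
  have hρ := (rhoP_pos h0 h2).le
  induction N with
  | zero => simpa [partialNorm] using (tauP_pos h0 h2).le
  | succ N ih =>
    refine (partialNorm_treeSeries_succ_le h0 hρ N).trans ?_
    refine (mul_le_mul_of_nonneg_left (seriesEval_truncExp_mono P
      (partialNorm_nonneg _ hρ N) ih) hρ).trans_eq (rhoP_mul h0 h2)

lemma summable_treeSeries_rhoP :
    Summable fun n => ‖PowerSeries.coeff n (treeSeries P)‖ * rhoP P ^ n :=
  (summable_of_partialNorm_le (rhoP_pos h0 h2).le (partialNorm_treeSeries_le h0 h2)).1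

lemma summable_norm_treeSeries {z : ℂ} (hz : ‖z‖ ≤ rhoP P) :
    Summable fun n => ‖PowerSeries.coeff n (treeSeries P) * z ^ n‖ :=
  Summable.of_nonneg_of_le (fun _ => norm_nonneg _) (norm_treeSeries_term_le hz)
    (summable_treeSeries_rhoP h0 h2)

lemma norm_seriesEval_treeSeries_le {z : ℂ} (hz : ‖z‖ ≤ rhoP P) :
    ‖seriesEval (treeSeries P) z‖ ≤ tauP P := by
  refine (norm_tsum_le_tsum_norm (summable_norm_treeSeries h0 h2 hz)).trans ?_
  refine ((summable_norm_treeSeries h0 h2 hz).tsum_le_tsum (norm_treeSeries_term_le hz)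
    (summable_treeSeries_rhoP h0 h2)).trans ?_
  exact (summable_of_partialNorm_le (rhoP_pos h0 h2).le (partialNorm_treeSeries_le h0 h2)).2

lemma continuousOn_treeSeries :
    ContinuousOn (seriesEval (treeSeries P)) (Metric.closedBall 0 (rhoP P)) :=
  continuousOn_tsum (fun n => by fun_prop) (summable_treeSeries_rhoP h0 h2)
    fun n _ hz => norm_treeSeries_term_le (mem_closedBall_zero_iff.1 hz) n

lemma summable_truncExp_treeSeries {z : ℂ} (hz : ‖z‖ ≤ rhoP P) :
    Summable fun p : ℕ × ℕ => PowerSeries.coeff p.1 (truncExp ℂ P) *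
      (PowerSeries.coeff p.2 (treeSeries P ^ p.1) * z ^ p.2) := by
  have hρ := (rhoP_pos h0 h2).le
  have hle := fun s => summable_of_partialNorm_le hρ fun N =>
    (partialNorm_pow_le (treeSeries P) hρ N s).trans
      (pow_le_pow_left₀ (partialNorm_nonneg _ hρ N) (partialNorm_treeSeries_le h0 h2 N) s)
  have hsum := summable_prod_mul_of_tsum_le (coeff_truncExp_nonneg P)
    (b := fun s n => ‖PowerSeries.coeff n (treeSeries P ^ s)‖ * rhoP P ^ n)
    (fun s n => mul_nonneg (norm_nonneg _) (pow_nonneg hρ _)) (fun s => (hle s).1)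
    (fun s => (hle s).2) (hasSum_truncExp P (tauP P)).summable
  refine Summable.of_norm_bounded hsum fun p => ?_
  rw [norm_mul, norm_mul, norm_pow, norm_coeff_truncExp]
  have := coeff_truncExp_nonneg P p.1
  gcongr

/-- The functional equation `T(z) = z e_P(T(z))` on the closed disc of radius `ρ_P`. -/
lemma seriesEval_treeSeries_eq {z : ℂ} (hz : ‖z‖ ≤ rhoP P) :
    seriesEval (treeSeries P) z =
      z * seriesEval (truncExp ℂ P) (seriesEval (treeSeries P) z) := by
  have hT := summable_norm_treeSeries h0 h2 hz
  have hF := summable_truncExp_treeSeries h0 h2 hz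
  have h1 : seriesEval (treeSeries P) z =
      ∑' n, PowerSeries.coeff (n + 1) (treeSeries P) * z ^ (n + 1) := by
    rw [seriesEval, hT.of_norm.tsum_eq_zero_add, coeff_zero_treeSeries h0, zero_mul, zero_add]
  have hn : ∀ n, PowerSeries.coeff (n + 1) (treeSeries P) * z ^ (n + 1) =
      z * ∑ s ∈ Finset.range (n + 1), PowerSeries.coeff s (truncExp ℂ P) *
        (PowerSeries.coeff n (treeSeries P ^ s) * z ^ n) := fun n => by
    rw [coeff_succ_treeSeries h0, Finset.sum_mul, Finset.mul_sum]
    exact Finset.sum_congr rfl fun s _ => by rw [pow_succ]; ring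
  have hlt : ∀ s n, n < s → PowerSeries.coeff n (treeSeries P ^ s) * z ^ n = 0 := fun s n h => by
    rw [coeff_treeSeries_pow_of_lt h0 h, zero_mul]
  have key := tsum_sum_range_mul (a := fun s => PowerSeries.coeff s (truncExp ℂ P))
    (g := fun s n => PowerSeries.coeff n (treeSeries P ^ s) * z ^ n)
    (v := fun s => seriesEval (treeSeries P) z ^ s) hF (fun s => (seriesEval_pow hT s).2) hlt
  conv_lhs => rw [h1]
  rw [tsum_congr hn, tsum_mul_left, key, seriesEval.eq_1 (truncExp ℂ P)]

/-- Nonnegative coefficients make `T(x)` real and nonnegative; the last clause is the functional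
equation solved for `x`. -/
lemma exists_treeSeries_ofReal_eq {x : ℝ} (hx0 : 0 ≤ x) (hx : x ≤ rhoP P) :
    ∃ y : ℝ, 0 ≤ y ∧ y ≤ tauP P ∧ seriesEval (treeSeries P) (x : ℂ) = (y : ℂ) ∧
      y / seriesEval (truncExp ℝ P) y = x := by
  have hxn : ‖(x : ℂ)‖ ≤ rhoP P := by rwa [Complex.norm_of_nonneg hx0]
  set y : ℝ := ∑' n, ((constrainedTrees P n).ncard : ℝ) / (n.factorial : ℝ) * x ^ n with hy
  have hTy : seriesEval (treeSeries P) (x : ℂ) = (y : ℂ) := by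
    rw [hy, Complex.ofReal_tsum, seriesEval]
    refine tsum_congr fun n => ?_
    rw [treeSeries, PowerSeries.coeff_mk]
    push_cast
    rfl
  have hy0 : 0 ≤ y := tsum_nonneg fun n => by positivity
  have hyτ : y ≤ tauP P := by
    have := norm_seriesEval_treeSeries_le h0 h2 hxn
    rwa [hTy, Complex.norm_of_nonneg hy0] at this
  refine ⟨y, hy0, hyτ, hTy, ?_⟩
  have h := seriesEval_treeSeries_eq h0 h2 hxn
  rw [hTy, ← ofReal_seriesEval_truncExp] at h
  have h' : y = x * seriesEval (truncExp ℝ P) y := by exact_mod_cast h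
  rw [div_eq_iff (one_pos.trans_le (one_le_seriesEval_truncExp h0 hy0)).ne']
  exact h'

lemma treeSeries_rhoP : seriesEval (treeSeries P) (rhoP P : ℂ) = (tauP P : ℂ) := by
  obtain ⟨y, hy0, hyτ, hTy, hy⟩ := exists_treeSeries_ofReal_eq h0 h2 (rhoP_pos h0 h2).le le_rfl
  rw [hTy, (strictMonoOn_div_truncExp h0 h2).injOn ⟨hy0, hyτ⟩ ⟨(tauP_pos h0 h2).le, le_rfl⟩ hy]

lemma exists_treeSeries_ofReal_lt {x : ℝ} (hx0 : 0 ≤ x) (hx : x < rhoP P) :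
    ∃ y : ℝ, y < tauP P ∧ seriesEval (treeSeries P) (x : ℂ) = (y : ℂ) := by
  obtain ⟨y, hy0, hyτ, hTy, hy⟩ := exists_treeSeries_ofReal_eq h0 h2 hx0 hx.le
  refine ⟨y, lt_of_le_of_ne hyτ ?_, hTy⟩
  rintro rfl
  exact hx.ne hy.symm

lemma rhoP_le_seriesRadius : ENNReal.ofReal (rhoP P) ≤ seriesRadius (treeSeries P) :=
  le_seriesRadius (rhoP_pos h0 h2).le (summable_treeSeries_rhoP h0 h2)

lemma analyticOnNhd_treeSeries :
    AnalyticOnNhd ℂ (seriesEval (treeSeries P)) (Metric.ball 0 (rhoP P)) := by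
  have hle := rhoP_le_seriesRadius h0 h2
  have h := hasFPowerSeriesOnBall_seriesEval
    ((ENNReal.ofReal_pos.2 (rhoP_pos h0 h2)).trans_le hle)
  refine h.analyticOnNhd.mono ?_
  rw [← Metric.eball_ofReal]
  exact Metric.eball_subset_eball hle

/-- With a larger radius, `T` would be differentiable at `ρ`, and the functional equation would give
`T' = e_P(τ) + ρ e_P'(τ) T' = e_P(τ) + T'`, contradicting `e_P(τ) > 0`. -/
lemma seriesRadius_treeSeries : seriesRadius (treeSeries P) = ENNReal.ofReal (rhoP P) := by
  have hle := rhoP_le_seriesRadius h0 h2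
  refine le_antisymm (not_lt.1 fun hlt => ?_) hle
  have hρ := rhoP_pos h0 h2
  have han := (hasFPowerSeriesOnBall_seriesEval
    ((ENNReal.ofReal_pos.2 hρ).trans_le hle)).analyticOnNhd (rhoP P : ℂ) (by
      rw [Metric.mem_eball, edist_zero_right]
      refine lt_of_eq_of_lt ?_ hlt
      rw [← ofReal_norm, Complex.norm_of_nonneg hρ.le])
  set d := deriv (seriesEval (treeSeries P)) (rhoP P : ℂ)
  have hd : HasDerivAt (fun x : ℝ => seriesEval (treeSeries P) (x : ℂ)) d (rhoP P) :=
    han.differentiableAt.hasDerivAt.comp_ofReal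
  have he := hasDerivAt_truncExp P (seriesEval (treeSeries P) (rhoP P : ℂ))
  have hid : HasDerivAt (fun x : ℝ => (x : ℂ)) 1 (rhoP P) := by
    simpa using (hasDerivAt_id (rhoP P : ℂ)).comp_ofReal
  have hΦ := hd.fun_sub (hid.fun_mul (he.comp (rhoP P) hd))
  have hzero : HasDerivWithinAt (fun x : ℝ => seriesEval (treeSeries P) (x : ℂ) -
      (x : ℂ) * (seriesEval (truncExp ℂ P) ∘ fun x : ℝ => seriesEval (treeSeries P) (x : ℂ)) x)
      0 (Set.Icc 0 (rhoP P)) (rhoP P) := by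
    have hc : Set.EqOn (fun x : ℝ => seriesEval (treeSeries P) (x : ℂ) -
      (x : ℂ) * (seriesEval (truncExp ℂ P) ∘ fun x : ℝ => seriesEval (treeSeries P) (x : ℂ)) x)
      (fun _ => (0 : ℂ)) (Set.Icc 0 (rhoP P)) := fun x hx => by
      have := seriesEval_treeSeries_eq h0 h2 (z := (x : ℂ))
        (by rw [Complex.norm_of_nonneg hx.1]; exact hx.2)
      exact sub_eq_zero.2 this
    exact (hasDerivWithinAt_const _ _ _).congr hc (hc ⟨hρ.le, le_rfl⟩)
  -- The equation is known only up to `ρ`, so derivatives are compared from the left.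
  have huniq := (uniqueDiffOn_Icc hρ (rhoP P) ⟨hρ.le, le_rfl⟩).eq_deriv _
    hΦ.hasDerivWithinAt hzero
  rw [Function.comp_apply, treeSeries_rhoP h0 h2, ← ofReal_seriesEval_truncExp,
    ← ofReal_seriesEval_truncExp, one_mul, ← mul_assoc, ← Complex.ofReal_mul,
    rhoP_mul_deriv h0 h2, Complex.ofReal_one, one_mul] at huniq
  have : ((seriesEval (truncExp ℝ P) (tauP P) : ℝ) : ℂ) = 0 := by linear_combination -huniq
  exact (seriesEval_tauP_pos h0 h2).ne' (by exact_mod_cast this)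

end TreeSeries

/-! ### Gluing local analytic continuations -/

section Gluing

lemma isClosed_realRay (ρ : ℝ) : IsClosed (realRay ρ) := by
  have : realRay ρ = (fun x : ℝ => (x : ℂ)) '' Set.Ici ρ := by
    ext z
    simp only [realRay, Set.mem_ofPred_eq, Set.mem_image, Set.mem_Ici]
    exact ⟨fun ⟨x, hx, h⟩ => ⟨x, hx, h.symm⟩, fun ⟨x, hx, h⟩ => ⟨x, hx, h.symm⟩⟩
  rw [this]
  exact Complex.isometry_ofReal.isClosedEmbedding.isClosedMap _ isClosed_Ici

lemma notMem_realRay_of_mem_ball {ρ : ℝ} {z : ℂ} (hz : z ∈ Metric.ball (0 : ℂ) ρ) :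
    z ∉ realRay ρ := by
  rintro ⟨x, hx, rfl⟩
  rw [mem_ball_zero_iff, Complex.norm_real] at hz
  exact (hx.trans (le_abs_self x)).not_gt hz

lemma norm_sub_le_norm_sub_of_mem_realRay {ρ : ℝ} {x w : ℂ} (hx : ‖x‖ = ρ)
    (hw : w ∈ realRay ρ) : ‖x - ρ‖ ≤ ‖x - w‖ := by
  obtain ⟨t, ht, rfl⟩ := hw
  have hre : x.re ≤ ρ := hx ▸ Complex.re_le_norm x
  rw [Complex.norm_def, Complex.norm_def]
  refine Real.sqrt_le_sqrt ?_
  rw [Complex.normSq_apply, Complex.normSq_apply]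
  simp only [Complex.sub_re, Complex.ofReal_re, Complex.sub_im, Complex.ofReal_im]
  nlinarith

/-- Two analytic functions on the intersection of two discs centred on the circle of radius `ρ`
agree if both continue the same function from the disc of radius `ρ`. -/
lemma eqOn_inter_ball_of_eqOn {ρ s s' : ℝ} {x x' : ℂ} {f g g' : ℂ → ℂ} (hρ : 0 < ρ)
    (hx : ‖x‖ ≤ ρ) (hx' : ‖x'‖ ≤ ρ)
    (hg : AnalyticOnNhd ℂ g (Metric.ball x s ∩ Metric.ball x' s'))
    (hg' : AnalyticOnNhd ℂ g' (Metric.ball x s ∩ Metric.ball x' s'))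
    (hgf : Set.EqOn g f (Metric.ball x s ∩ Metric.ball x' s' ∩ Metric.ball 0 ρ))
    (hgf' : Set.EqOn g' f (Metric.ball x s ∩ Metric.ball x' s' ∩ Metric.ball 0 ρ)) :
    Set.EqOn g g' (Metric.ball x s ∩ Metric.ball x' s') := by
  rintro z ⟨hz, hz'⟩
  have hs : 0 < s := dist_nonneg.trans_lt (Metric.mem_ball.1 hz)
  have hs' : 0 < s' := dist_nonneg.trans_lt (Metric.mem_ball.1 hz')
  have hd : ‖x' - x‖ < s + s' := by
    rw [← dist_eq_norm]
    exact (dist_triangle_left x' x z).trans_lt (by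
      rw [add_comm s]; exact add_lt_add (Metric.mem_ball.1 hz') (Metric.mem_ball.1 hz))
  set U := Metric.ball x s ∩ Metric.ball x' s' with hU
  have hUo : IsOpen U := Metric.isOpen_ball.inter Metric.isOpen_ball
  -- As `‖x' - x‖ < s + s'`, the point dividing the segment from `x` to `x'` in the ratio `s : s'`
  -- lies in both discs, and by convexity in the closed disc of radius `ρ`. A nearby point of the
  -- open disc then starts the identity theorem.
  obtain ⟨p, hpU, hp⟩ : ∃ p ∈ U, p ∈ Metric.closedBall (0 : ℂ) ρ := by
    refine ⟨(s' / (s + s')) • x + (s / (s + s')) • x', ⟨?_, ?_⟩, ?_⟩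
    · have : (s' / (s + s')) • x + (s / (s + s')) • x' - x = (s / (s + s')) • (x' - x) := by
        have h1 : s' / (s + s') = 1 - s / (s + s') := by field_simp; ring
        rw [h1]
        module
      rw [mem_ball_iff_norm, this, norm_smul, Real.norm_of_nonneg (by positivity)]
      calc _ < s / (s + s') * (s + s') := by gcongr
        _ = s := by field_simp
    · have : (s' / (s + s')) • x + (s / (s + s')) • x' - x' = (s' / (s + s')) • (x - x') := by
        have h1 : s / (s + s') = 1 - s' / (s + s') := by field_simp; ring
        rw [h1]
        module
      rw [mem_ball_iff_norm, this, norm_smul, Real.norm_of_nonneg (by positivity), norm_sub_rev]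
      calc _ < s' / (s + s') * (s + s') := by gcongr
        _ = s' := by field_simp
    · exact convex_closedBall (0 : ℂ) ρ (mem_closedBall_zero_iff.2 hx)
        (mem_closedBall_zero_iff.2 hx') (by positivity) (by positivity) (by field_simp; ring)
  rw [← closure_ball (0 : ℂ) hρ.ne'] at hp
  obtain ⟨p', hp'U, hp'⟩ := mem_closure_iff.1 hp U hUo hpU
  have hev : g =ᶠ[𝓝 p'] g' := by
    filter_upwards [(hUo.inter Metric.isOpen_ball).mem_nhds ⟨hp'U, hp'⟩] with y hy
    rw [hgf hy, hgf' hy]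
  exact hg.eqOn_of_preconnected_of_eventuallyEq hg'
    ((convex_ball x s).inter (convex_ball x' s')).isPreconnected hp'U hev ⟨hz, hz'⟩

lemma exists_uniform_extension {ρ : ℝ} {f : ℂ → ℂ} {K : Set ℂ} (hK : IsCompact K)
    (hloc : ∀ x ∈ K, ∃ g : ℂ → ℂ, AnalyticAt ℂ g x ∧ ∀ᶠ z in 𝓝[Metric.ball 0 ρ] x, g z = f z) :
    ∃ s : ℝ, 0 < s ∧ ∀ x ∈ K, ∃ g : ℂ → ℂ, AnalyticOnNhd ℂ g (Metric.ball x s) ∧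
      Set.EqOn g f (Metric.ball x s ∩ Metric.ball 0 ρ) := by
  have h : ∀ x : K, ∃ (g : ℂ → ℂ) (ε : ℝ), 0 < ε ∧ AnalyticOnNhd ℂ g (Metric.ball (x : ℂ) ε) ∧
      Set.EqOn g f (Metric.ball (x : ℂ) ε ∩ Metric.ball 0 ρ) := by
    rintro ⟨x, hx⟩
    obtain ⟨g, hg, hgf⟩ := hloc x hx
    obtain ⟨ε, hε, hball⟩ := Metric.eventually_nhds_iff_ball.1
      (hg.eventually_analyticAt.and (eventually_nhdsWithin_iff.1 hgf))
    exact ⟨g, ε, hε, fun z hz => (hball z hz).1, fun z hz => (hball z hz.1).2 hz.2⟩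
  choose g ε hε hg hgf using h
  obtain ⟨s, hs, hcov⟩ := lebesgue_number_lemma_of_metric hK
    (c := fun x : K => Metric.ball (x : ℂ) (ε x)) (fun _ => Metric.isOpen_ball)
    (fun x hx => Set.mem_iUnion.2 ⟨⟨x, hx⟩, Metric.mem_ball_self (hε _)⟩)
  refine ⟨s, hs, fun x hx => ?_⟩
  obtain ⟨i, hi⟩ := hcov x hx
  exact ⟨g i, (hg i).mono hi, (hgf i).mono (Set.inter_subset_inter_left _ hi)⟩

/-- A function which is analytic on a disc and has an analytic continuation near every boundary
point, except for one boundary point `ρ` with an analytic continuation to a slit disc around `ρ`,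
extends analytically to a larger slit disc. -/
lemma exists_extension_slit_ball {ρ δ : ℝ} {f g₀ : ℂ → ℂ} (hρ : 0 < ρ) (hδ : 0 < δ)
    (hf : AnalyticOnNhd ℂ f (Metric.ball 0 ρ))
    (hg₀ : AnalyticOnNhd ℂ g₀ (Metric.ball (ρ : ℂ) δ \ realRay ρ))
    (hg₀f : Set.EqOn g₀ f (Metric.ball (ρ : ℂ) δ ∩ Metric.ball 0 ρ))
    (hloc : ∀ x : ℂ, ‖x‖ = ρ → x ≠ ρ →
      ∃ g : ℂ → ℂ, AnalyticAt ℂ g x ∧ ∀ᶠ z in 𝓝[Metric.ball 0 ρ] x, g z = f z) :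
    ∃ r : ℝ, ρ < r ∧ ∃ F : ℂ → ℂ, AnalyticOnNhd ℂ F (Metric.ball 0 r \ realRay ρ) ∧
      Set.EqOn F f (Metric.ball 0 ρ) ∧ Set.EqOn F g₀ (Metric.ball (ρ : ℂ) δ \ realRay ρ) := by
  classical
  have hρn : ‖(ρ : ℂ)‖ = ρ := Complex.norm_of_nonneg hρ.le
  -- Only half of `δ` is removed, so that the discs around points of `K` overlap the disc around `ρ`
  -- and, with radius at most `δ / 2`, still miss the ray.
  set K : Set ℂ := Metric.sphere 0 ρ \ Metric.ball (ρ : ℂ) (δ / 2) with hKdef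
  have hK : IsCompact K := (isCompact_sphere 0 ρ).diff Metric.isOpen_ball
  have hKn : ∀ x ∈ K, ‖x‖ = ρ := fun x hx => mem_sphere_zero_iff_norm.1 hx.1
  have hKd : ∀ x ∈ K, δ / 2 ≤ ‖x - ρ‖ := fun x hx => by
    simpa only [mem_ball_iff_norm, not_lt] using hx.2
  obtain ⟨s₀, hs₀, hext₀⟩ := exists_uniform_extension hK (fun x hx => hloc x (hKn x hx) (by
    rintro rfl
    have := hKd _ hx
    rw [sub_self, norm_zero] at this
    linarith))
  set s := min s₀ (δ / 2) with hs
  have hs0 : 0 < s := lt_min hs₀ (by positivity)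
  have hsub : ∀ x : ℂ, Metric.ball x s ⊆ Metric.ball x s₀ := fun x =>
    Metric.ball_subset_ball (min_le_left _ _)
  -- Extensions are chosen for all `x`, with a dummy value off `K`, so that `G (π z)` needs no proof
  -- of membership.
  have hext : ∀ x : ℂ, ∃ g : ℂ → ℂ, x ∈ K → AnalyticOnNhd ℂ g (Metric.ball x s) ∧
      Set.EqOn g f (Metric.ball x s ∩ Metric.ball 0 ρ) := fun x => by
    by_cases hx : x ∈ K
    · obtain ⟨g, hg, hgf⟩ := hext₀ x hx
      exact ⟨g, fun _ => ⟨hg.mono (hsub x), hgf.mono (Set.inter_subset_inter_left _ (hsub x))⟩⟩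
    · exact ⟨0, fun h => absurd h hx⟩
  choose G hG using hext
  -- Radial projection to the circle selects which local extension defines `F` at `z`.
  set π : ℂ → ℂ := fun z => ((ρ / ‖z‖ : ℝ) : ℂ) * z with hπ
  have hπdist : ∀ z : ℂ, ρ ≤ ‖z‖ → ‖z - π z‖ = ‖z‖ - ρ := fun z hz => by
    have hz0 : 0 < ‖z‖ := hρ.trans_le hz
    have h1 : z - π z = ((1 - ρ / ‖z‖ : ℝ) : ℂ) * z := by
      simp only [hπ]
      push_cast
      ring
    have h2 : 0 ≤ 1 - ρ / ‖z‖ := sub_nonneg.2 ((div_le_one hz0).2 hz)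
    rw [h1, norm_mul, Complex.norm_of_nonneg h2]
    field_simp
  have hπK : ∀ z : ℂ, ρ ≤ ‖z‖ → ‖z‖ < ρ + s → z ∉ Metric.ball (ρ : ℂ) δ →
      π z ∈ K ∧ z ∈ Metric.ball (π z) s := fun z hz hzs hzδ => by
    have hz0 : 0 < ‖z‖ := hρ.trans_le hz
    have hd := hπdist z hz
    refine ⟨⟨?_, ?_⟩, ?_⟩
    · rw [mem_sphere_zero_iff_norm]
      simp only [hπ]
      rw [norm_mul, Complex.norm_of_nonneg (by positivity)]
      field_simp
    · rw [mem_ball_iff_norm, not_lt] at hzδ ⊢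
      have h1 : ‖z - ρ‖ ≤ ‖z - π z‖ + ‖π z - ρ‖ := norm_sub_le_norm_sub_add_norm_sub _ _ _
      have h2 : s ≤ δ / 2 := min_le_right _ _
      linarith
    · rw [mem_ball_iff_norm, hd]
      linarith
  set F : ℂ → ℂ := fun z => if z ∈ Metric.ball (0 : ℂ) ρ then f z
    else if z ∈ Metric.ball (ρ : ℂ) δ then g₀ z else G (π z) z with hF
  have hFf : Set.EqOn F f (Metric.ball 0 ρ) := fun z hz => by simp only [hF, if_pos hz]
  have hFg₀ : Set.EqOn F g₀ (Metric.ball (ρ : ℂ) δ \ realRay ρ) := fun z hz => by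
    by_cases hzρ : z ∈ Metric.ball (0 : ℂ) ρ
    · rw [hFf hzρ, hg₀f ⟨hz.1, hzρ⟩]
    · simp only [hF, if_neg hzρ, if_pos hz.1]
  have havoid : ∀ x ∈ K, ∀ z ∈ Metric.ball x s, z ∉ realRay ρ := fun x hx z hz hzr => by
    have h1 := norm_sub_le_norm_sub_of_mem_realRay (hKn x hx) hzr
    rw [mem_ball_iff_norm, norm_sub_rev] at hz
    have h2 : s ≤ δ / 2 := min_le_right _ _
    have h3 := hKd x hx
    linarith
  have hFG : ∀ x ∈ K, Set.EqOn F (G x) (Metric.ball x s ∩ Metric.ball 0 (ρ + s)) := by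
    rintro x hx z ⟨hz, hzr⟩
    by_cases hzρ : z ∈ Metric.ball (0 : ℂ) ρ
    · rw [hFf hzρ, (hG x hx).2 ⟨hz, hzρ⟩]
    by_cases hzδ : z ∈ Metric.ball (ρ : ℂ) δ
    · rw [hFg₀ ⟨hzδ, havoid x hx z hz⟩]
      have h := eqOn_inter_ball_of_eqOn hρ hρn.le (hKn x hx).le
        (hg₀.mono fun y hy => Set.mem_sdiff_of_mem hy.1 (havoid x hx y hy.2))
        ((hG x hx).1.mono Set.inter_subset_right)
        (hg₀f.mono (Set.inter_subset_inter_left _ Set.inter_subset_left))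
        ((hG x hx).2.mono (Set.inter_subset_inter_left _ Set.inter_subset_right))
      exact h ⟨hzδ, hz⟩
    · have hzn : ρ ≤ ‖z‖ := by simpa using hzρ
      obtain ⟨hπz, hzπ⟩ := hπK z hzn (by simpa using hzr) hzδ
      simp only [hF, if_neg hzρ, if_neg hzδ]
      have h := eqOn_inter_ball_of_eqOn hρ (hKn _ hπz).le (hKn x hx).le
        ((hG _ hπz).1.mono Set.inter_subset_left)
        ((hG x hx).1.mono Set.inter_subset_right)
        ((hG _ hπz).2.mono (Set.inter_subset_inter_left _ Set.inter_subset_left))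
        ((hG x hx).2.mono (Set.inter_subset_inter_left _ Set.inter_subset_right))
      exact h ⟨hzπ, hz⟩
  refine ⟨ρ + s, by linarith, F, ?_, hFf, hFg₀⟩
  rintro z ⟨hzr, hzray⟩
  by_cases hzρ : z ∈ Metric.ball (0 : ℂ) ρ
  · exact (hf z hzρ).congr (hFf.symm.eventuallyEq_of_mem (Metric.isOpen_ball.mem_nhds hzρ))
  by_cases hzδ : z ∈ Metric.ball (ρ : ℂ) δ
  · exact (hg₀ z ⟨hzδ, hzray⟩).congr (hFg₀.symm.eventuallyEq_of_mem
      ((Metric.isOpen_ball.sdiff (isClosed_realRay ρ)).mem_nhds ⟨hzδ, hzray⟩))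
  · obtain ⟨hπz, hzπ⟩ := hπK z (by simpa using hzρ) (by simpa using hzr) hzδ
    exact ((hG _ hπz).1 z hzπ).congr ((hFG _ hπz).symm.eventuallyEq_of_mem
      ((Metric.isOpen_ball.inter Metric.isOpen_ball).mem_nhds ⟨hzπ, hzr⟩))

end Gluing

/-! ### Continuation across regular boundary points -/

section RegularPoints

variable {P : Set ℕ}

/-- Equality in the triangle inequality: projected to the direction of the sum `S`, each term is at
most its norm, and the totals agree, so all terms point in the direction of `S`. -/
lemma pow_eq_norm_pow_of_norm_truncExp_eq (h0 : 0 ∈ P) {y : ℂ}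
    (h : ‖seriesEval (truncExp ℂ P) y‖ = seriesEval (truncExp ℝ P) ‖y‖) {n : ℕ} (hn : n ∈ P) :
    y ^ n = (‖y‖ : ℂ) ^ n := by
  set S := seriesEval (truncExp ℂ P) y with hS
  set R := seriesEval (truncExp ℝ P) ‖y‖ with hR
  have hR0 : 0 < R := one_pos.trans_le (one_le_seriesEval_truncExp h0 (norm_nonneg y))
  have hterm : ∀ m, (starRingEnd ℂ S * (PowerSeries.coeff m (truncExp ℂ P) * y ^ m)).re ≤
      R * (PowerSeries.coeff m (truncExp ℝ P) * ‖y‖ ^ m) := fun m => by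
    refine (Complex.re_le_norm _).trans_eq ?_
    rw [norm_mul, norm_truncExp_term, Complex.norm_conj, h]
  have hsum1 : HasSum (fun m => (starRingEnd ℂ S *
      (PowerSeries.coeff m (truncExp ℂ P) * y ^ m)).re) (R * R) := by
    have h1 := Complex.hasSum_re ((hasSum_truncExp P y).mul_left (starRingEnd ℂ S))
    have h2 : (starRingEnd ℂ S * S).re = R * R := by
      rw [Complex.conj_mul', h]
      norm_cast
      ring
    rwa [← hS, h2] at h1
  have hsum2 : HasSum (fun m => R * (PowerSeries.coeff m (truncExp ℝ P) * ‖y‖ ^ m)) (R * R) :=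
    (hasSum_truncExp P ‖y‖).mul_left R
  have heq : ∀ m, (starRingEnd ℂ S * (PowerSeries.coeff m (truncExp ℂ P) * y ^ m)).re =
      R * (PowerSeries.coeff m (truncExp ℝ P) * ‖y‖ ^ m) := fun m => by
    by_contra hne
    exact (hasSum_lt hterm (lt_of_le_of_ne (hterm m) hne) hsum1 hsum2).ne rfl
  -- The term of index `0` is `1`, so the common direction is that of the positive reals.
  have hSR : S = R := by
    have h1 := heq 0
    rw [coeff_truncExp_of_mem h0, coeff_truncExp_of_mem h0] at h1
    simp only [Nat.factorial_zero, Nat.cast_one, inv_one, pow_zero, mul_one,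
      Complex.conj_re] at h1
    have h3 : S.im = 0 := Complex.abs_re_eq_norm.1 (by rw [h1, h, abs_of_pos hR0])
    exact Complex.ext (by simpa using h1) (by simpa using h3)
  have h2 := heq n
  rw [hSR, Complex.conj_ofReal, Complex.re_ofReal_mul, ← ofReal_coeff_truncExp,
    Complex.re_ofReal_mul] at h2
  have h3 : (y ^ n).re = ‖y ^ n‖ := by
    rw [norm_pow]
    exact mul_left_cancel₀ (coeff_truncExp_pos hn).ne' (mul_left_cancel₀ hR0.ne' h2)
  have h4 : (y ^ n).im = 0 := Complex.abs_re_eq_norm.1 (by rw [h3, abs_norm])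
  rw [norm_pow] at h3
  rw [← Complex.ofReal_pow]
  exact Complex.ext (by rw [h3, Complex.ofReal_re]) (by rw [h4, Complex.ofReal_im])

/-- The order of `y / ‖y‖` divides every element of `P`, hence their gcd. -/
lemma eq_norm_of_norm_truncExp_eq (h0 : 0 ∈ P) (hP : Nat.setGcd P = 1) {y : ℂ}
    (h : ‖seriesEval (truncExp ℂ P) y‖ = seriesEval (truncExp ℝ P) ‖y‖) : y = (‖y‖ : ℂ) := by
  by_cases hy : y = 0
  · simp [hy]
  have hy' : (‖y‖ : ℂ) ≠ 0 := by simpa using hy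
  have hdvd : orderOf (y / ‖y‖) ∣ 1 := by
    rw [← hP, Nat.dvd_setGcd_iff]
    intro n hn
    rw [orderOf_dvd_iff_pow_eq_one, div_pow, pow_eq_norm_pow_of_norm_truncExp_eq h0 h hn,
      div_self (pow_ne_zero n hy')]
  have := orderOf_eq_one_iff.1 (Nat.dvd_one.1 hdvd)
  rwa [div_eq_one_iff_eq hy'] at this

variable (h0 : 0 ∈ P) (h2 : (shiftDown P 2).Nonempty)
include h0 h2

lemma truncExp_treeSeries_ne_zero {z : ℂ} (hz : ‖z‖ ≤ rhoP P) :
    seriesEval (truncExp ℂ P) (seriesEval (treeSeries P) z) ≠ 0 := fun h => by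
  have h1 := seriesEval_treeSeries_eq h0 h2 hz
  rw [h, mul_zero] at h1
  rw [h1, seriesEval_truncExp_zero h0] at h
  exact one_ne_zero h

lemma treeSeries_div_truncExp {z : ℂ} (hz : ‖z‖ ≤ rhoP P) :
    seriesEval (treeSeries P) z / seriesEval (truncExp ℂ P) (seriesEval (treeSeries P) z) = z := by
  rw [div_eq_iff (truncExp_treeSeries_ne_zero h0 h2 hz)]
  exact seriesEval_treeSeries_eq h0 h2 hz

lemma norm_treeSeries_lt (hP : Nat.setGcd P = 1) {z : ℂ} (hz : ‖z‖ = rhoP P)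
    (hne : z ≠ rhoP P) : ‖seriesEval (treeSeries P) z‖ < tauP P := by
  refine lt_of_le_of_ne (norm_seriesEval_treeSeries_le h0 h2 hz.le) fun h => hne ?_
  have h1 := seriesEval_treeSeries_eq h0 h2 hz.le
  have h3 : ‖seriesEval (truncExp ℂ P) (seriesEval (treeSeries P) z)‖ =
      seriesEval (truncExp ℝ P) ‖seriesEval (treeSeries P) z‖ := by
    have h4 := congrArg norm h1
    rw [norm_mul, hz, h, ← rhoP_mul h0 h2] at h4
    rw [h]
    exact (mul_left_cancel₀ (rhoP_pos h0 h2).ne' h4).symm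
  have h5 := eq_norm_of_norm_truncExp_eq h0 hP h3
  have h6 := treeSeries_div_truncExp h0 h2 hz.le
  rw [h5, h, ← ofReal_seriesEval_truncExp] at h6
  rw [← h6, rhoP]
  push_cast
  rfl

/-- The hypothesis says that `ψ(u) = u / e_P(u)` has nonzero derivative at `T(z)`. Its local inverse
there is analytic and agrees with `T`, because `ψ(T(w)) = w` and `T` is continuous on the closed
disc. -/
lemma exists_extension_of_regular {z : ℂ} (hz : ‖z‖ ≤ rhoP P)
    (hreg : z * seriesEval (truncExp ℂ (shiftDown P 1)) (seriesEval (treeSeries P) z) ≠ 1) :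
    ∃ g : ℂ → ℂ, AnalyticAt ℂ g z ∧
      ∀ᶠ w in 𝓝[Metric.ball 0 (rhoP P)] z, g w = seriesEval (treeSeries P) w := by
  set y := seriesEval (treeSeries P) z with hy
  set ψ : ℂ → ℂ := fun u => u / seriesEval (truncExp ℂ P) u with hψ
  have hey : seriesEval (truncExp ℂ P) y ≠ 0 := truncExp_treeSeries_ne_zero h0 h2 hz
  have hψy : ψ y = z := treeSeries_div_truncExp h0 h2 hz
  have hana : AnalyticAt ℂ ψ y :=
    analyticAt_id.fun_div ((differentiable_truncExp P).analyticAt y) hey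
  have hd : deriv ψ y ≠ 0 := by
    rw [((hasDerivAt_id' y).fun_div (hasDerivAt_truncExp P y) hey).deriv]
    refine div_ne_zero ?_ (pow_ne_zero 2 hey)
    have hyz : y = z * seriesEval (truncExp ℂ P) y := seriesEval_treeSeries_eq h0 h2 hz
    intro h
    refine hreg (mul_right_cancel₀ hey ?_)
    linear_combination -h -
      seriesEval (truncExp ℂ (shiftDown P 1)) y * hyz
  have hloc := hana.analyticAt_localInverse hd
  rw [hψy] at hloc
  refine ⟨_, hloc, ?_⟩
  have hT : Tendsto (seriesEval (treeSeries P)) (𝓝[Metric.ball 0 (rhoP P)] z) (𝓝 y) :=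
    (continuousOn_treeSeries h0 h2 z (mem_closedBall_zero_iff.2 hz)).mono_left
      (nhdsWithin_mono _ Metric.ball_subset_closedBall)
  filter_upwards [hT.eventually (hana.hasStrictDerivAt.eventually_left_inverse hd),
    self_mem_nhdsWithin] with w hw hwρ
  have hψw : ψ (seriesEval (treeSeries P) w) = w :=
    treeSeries_div_truncExp h0 h2 (mem_ball_zero_iff.1 hwρ).le
  rwa [hψw] at hw

/-- Here `|T(z)| < τ`, so `|z e_P'(T(z))| < ρ e_P'(τ) = 1` and `z` is a regular point. -/
lemma exists_extension_of_norm_eq (hP : Nat.setGcd P = 1) {z : ℂ} (hz : ‖z‖ = rhoP P)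
    (hne : z ≠ rhoP P) : ∃ g : ℂ → ℂ, AnalyticAt ℂ g z ∧
      ∀ᶠ w in 𝓝[Metric.ball 0 (rhoP P)] z, g w = seriesEval (treeSeries P) w := by
  refine exists_extension_of_regular h0 h2 hz.le fun h => ?_
  obtain ⟨m, hm⟩ := h2
  have hlt : ‖z * seriesEval (truncExp ℂ (shiftDown P 1)) (seriesEval (treeSeries P) z)‖ < 1 := by
    rw [norm_mul, hz, ← rhoP_mul_deriv h0 ⟨m, hm⟩]
    refine mul_lt_mul_of_pos_left ?_ (rhoP_pos h0 ⟨m, hm⟩)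
    refine (norm_seriesEval_truncExp_le _ _).trans_lt ?_
    refine seriesEval_truncExp_strictMono (n := m + 1) ?_ (Nat.succ_ne_zero m) (norm_nonneg _)
      (norm_treeSeries_lt h0 ⟨m, hm⟩ hP hz hne)
    rw [mem_shiftDown] at hm ⊢
    exact hm
  rw [h, norm_one] at hlt
  exact lt_irrefl _ hlt

end RegularPoints

/-! ### The square root singularity -/

section SquareRoot

/-- The cofactor of the double zero is the twice iterated divided difference, entire by removability
of singularities. -/
lemma exists_eq_sub_sq_mul {f : ℂ → ℂ} (hf : Differentiable ℂ f) {a : ℂ} (ha : f a = 0)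
    (ha' : deriv f a = 0) :
    ∃ g : ℂ → ℂ, Differentiable ℂ g ∧ (∀ u, f u = (u - a) ^ 2 * g u) ∧
      2 * g a = deriv (deriv f) a := by
  have hds : ∀ k : ℂ → ℂ, Differentiable ℂ k → Differentiable ℂ (dslope k a) := fun k hk =>
    differentiableOn_univ.1 ((Complex.differentiableOn_dslope univ_mem).2 hk.differentiableOn)
  have hg := hds _ (hds f hf)
  set g := dslope (dslope f a) a with hgdef
  have hfg : ∀ u, f u = (u - a) ^ 2 * g u := fun u => by
    have h1 := sub_smul_dslope f a u
    have h2 := sub_smul_dslope (dslope f a) a u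
    rw [dslope_same, ha', sub_zero] at h2
    rw [ha, sub_zero, ← h2, smul_smul] at h1
    rw [← h1, smul_eq_mul, pow_two]
  refine ⟨g, hg, hfg, ?_⟩
  have hdg : Differentiable ℂ (deriv g) :=
    differentiableOn_univ.1 (hg.differentiableOn.deriv isOpen_univ)
  have hdf : deriv f = fun u => (u - a) * (2 * g u + (u - a) * deriv g u) := by
    funext u
    have h1 : HasDerivAt (fun u => (u - a) ^ 2 * g u) _ u :=
      (((hasDerivAt_id' u).sub_const a).fun_pow 2).fun_mul (hg u).hasDerivAt
    rw [show f = fun u => (u - a) ^ 2 * g u from funext hfg, h1.deriv]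
    push_cast
    ring
  have h2 : HasDerivAt (fun u => (u - a) * (2 * g u + (u - a) * deriv g u)) _ a :=
    ((hasDerivAt_id' a).sub_const a).fun_mul
      ((((hg a).hasDerivAt).const_mul 2).fun_add
        (((hasDerivAt_id' a).sub_const a).fun_mul (hdg a).hasDerivAt))
  rw [hdf, h2.deriv]
  ring

lemma ofReal_cpow_half {a : ℝ} (ha : 0 ≤ a) : (a : ℂ) ^ ((1 : ℂ) / 2) = (Real.sqrt a : ℂ) := by
  rw [Real.sqrt_eq_rpow, Complex.ofReal_cpow ha]
  norm_num

lemma cpow_half_sq (z : ℂ) : (z ^ ((1 : ℂ) / 2)) ^ 2 = z := by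
  rw [← Complex.cpow_nat_mul]
  norm_num

lemma tendsto_cpow_half_zero : Tendsto (fun z : ℂ => z ^ ((1 : ℂ) / 2)) (𝓝 0) (𝓝 0) := by
  rw [tendsto_zero_iff_norm_tendsto_zero]
  have h : (fun z : ℂ => ‖z ^ ((1 : ℂ) / 2)‖) = fun z => Real.sqrt ‖z‖ := by
    funext z
    have h1 := congrArg norm (cpow_half_sq z)
    rw [norm_pow] at h1
    rw [← h1, Real.sqrt_sq (norm_nonneg _)]
  rw [h]
  have h2 : Continuous fun z : ℂ => Real.sqrt ‖z‖ := by fun_prop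
  simpa using h2.tendsto 0

lemma one_sub_div_mem_slitPlane {ρ : ℝ} (hρ : 0 < ρ) {z : ℂ} (hz : z ∉ realRay ρ) :
    1 - z / ρ ∈ Complex.slitPlane := by
  rw [Complex.mem_slitPlane_iff_not_le_zero]
  intro h
  rw [Complex.le_def] at h
  simp only [Complex.sub_re, Complex.one_re, Complex.div_ofReal_re, Complex.zero_re,
    Complex.sub_im, Complex.one_im, Complex.div_ofReal_im, Complex.zero_im, zero_sub,
    neg_eq_zero, div_eq_zero_iff, hρ.ne', or_false] at h
  refine hz ⟨z.re, ?_, Complex.ext rfl (by simpa using h.2)⟩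
  have := h.1
  rw [sub_nonpos, le_div_iff₀ hρ] at this
  linarith

end SquareRoot

/-! ### Continuation to a slit disc around `ρ_P` -/

section Singularity

lemma one_sub_div_cpow_half_ne_zero {ρ : ℝ} (hρ : 0 < ρ) {z : ℂ} (hz : z ∉ realRay ρ) :
    (1 - z / ρ) ^ ((1 : ℂ) / 2) ≠ 0 := fun h => by
  have h1 := cpow_half_sq (1 - z / ρ)
  rw [h, zero_pow two_ne_zero] at h1
  exact Complex.slitPlane_ne_zero (one_sub_div_mem_slitPlane hρ hz) h1.symm

lemma tendsto_one_sub_div_cpow_half {ρ : ℝ} (hρ : 0 < ρ) :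
    Tendsto (fun z : ℂ => (1 - z / ρ) ^ ((1 : ℂ) / 2)) (𝓝 (ρ : ℂ)) (𝓝 0) := by
  refine tendsto_cpow_half_zero.comp ?_
  have hρ' : (ρ : ℂ) ≠ 0 := by exact_mod_cast hρ.ne'
  have hc : Continuous fun z : ℂ => 1 - z / ρ := by fun_prop
  simpa [div_self hρ'] using hc.tendsto (ρ : ℂ)

variable {P : Set ℕ} (h0 : 0 ∈ P) (h2 : (shiftDown P 2).Nonempty)
include h0 h2

/-- Near `τ_P`, the function `1 - u / (ρ_P e_P(u))` is the square of an analytic function. -/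
lemma exists_sq_eq_one_sub : ∃ h : ℂ → ℂ, AnalyticAt ℂ h (tauP P) ∧
    h (tauP P) = ((seriesEval (truncExp ℝ (shiftDown P 2)) (tauP P) /
      (2 * seriesEval (truncExp ℝ P) (tauP P)) : ℝ) : ℂ) ∧
    ∀ u, seriesEval (truncExp ℂ P) u ≠ 0 →
      (u - tauP P) ^ 2 * h u = 1 - u / seriesEval (truncExp ℂ P) u / rhoP P := by
  have hρ : (rhoP P : ℂ) ≠ 0 := by exact_mod_cast (rhoP_pos h0 h2).ne'
  have he : seriesEval (truncExp ℂ P) (tauP P) ≠ 0 := by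
    rw [← ofReal_seriesEval_truncExp]
    exact_mod_cast (seriesEval_tauP_pos h0 h2).ne'
  have hd1 : ∀ u : ℂ, HasDerivAt (fun u => (rhoP P : ℂ) * seriesEval (truncExp ℂ P) u - u)
      (rhoP P * seriesEval (truncExp ℂ (shiftDown P 1)) u - 1) u := fun u =>
    ((hasDerivAt_truncExp P u).const_mul _).fun_sub (hasDerivAt_id' u)
  have hd2 : ∀ u : ℂ, HasDerivAt
      (fun u => (rhoP P : ℂ) * seriesEval (truncExp ℂ (shiftDown P 1)) u - 1)
      (rhoP P * seriesEval (truncExp ℂ (shiftDown P 2)) u) u := fun u => by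
    have := (hasDerivAt_truncExp (shiftDown P 1) u).const_mul (rhoP P : ℂ)
    rw [shiftDown_shiftDown] at this
    exact this.sub_const 1
  -- `ρ e_P(u) - u` has a double zero at `τ`, by `ρ e_P(τ) = τ` and `ρ e_P'(τ) = 1`. Division by `ρ
  -- e_P(u)` turns it into `1 - ψ(u)/ρ`.
  obtain ⟨g, hg, hKg, hga⟩ := exists_eq_sub_sq_mul
    (f := fun u => (rhoP P : ℂ) * seriesEval (truncExp ℂ P) u - u) (a := (tauP P : ℂ))
    (fun u => (hd1 u).differentiableAt)
    (by rw [← ofReal_seriesEval_truncExp, ← Complex.ofReal_mul, rhoP_mul h0 h2, sub_self])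
    (by rw [(hd1 _).deriv, ← ofReal_seriesEval_truncExp, ← Complex.ofReal_mul,
      rhoP_mul_deriv h0 h2, Complex.ofReal_one, sub_self])
  refine ⟨fun u => g u / (rhoP P * seriesEval (truncExp ℂ P) u), ?_, ?_, fun u hu => ?_⟩
  · exact (hg.analyticAt _).fun_div
      (analyticAt_const.fun_mul ((differentiable_truncExp P).analyticAt _)) (mul_ne_zero hρ he)
  · rw [show deriv (fun u => (rhoP P : ℂ) * seriesEval (truncExp ℂ P) u - u) = _ from
      funext fun u => (hd1 u).deriv, (hd2 _).deriv, ← ofReal_seriesEval_truncExp] at hga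
    rw [← ofReal_seriesEval_truncExp] at he
    simp only [← ofReal_seriesEval_truncExp]
    push_cast
    field_simp
    linear_combination hga
  · rw [← mul_div_assoc, ← hKg u]
    field_simp

/-- The tree function continues to a slit disc around `ρ_P`, with a square root singularity. -/
lemma exists_sqrt_extension : ∃ δ : ℝ, 0 < δ ∧ ∃ g : ℂ → ℂ,
    AnalyticOnNhd ℂ g (Metric.ball (rhoP P : ℂ) δ \ realRay (rhoP P)) ∧
    Set.EqOn g (seriesEval (treeSeries P))
      (Metric.ball (rhoP P : ℂ) δ ∩ Metric.ball 0 (rhoP P)) ∧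
    Tendsto (fun z => ((tauP P : ℂ) - g z) / sqrtTerm P z)
      (𝓝[(realRay (rhoP P))ᶜ] (rhoP P : ℂ)) (𝓝 1) := by
  have hρ := rhoP_pos h0 h2
  have hρ' : (rhoP P : ℂ) ≠ 0 := by exact_mod_cast hρ.ne'
  obtain ⟨h, hana, hτ, hh⟩ := exists_sq_eq_one_sub h0 h2
  set κ : ℝ := seriesEval (truncExp ℝ (shiftDown P 2)) (tauP P) /
      (2 * seriesEval (truncExp ℝ P) (tauP P)) with hκ
  have he0 := seriesEval_tauP_pos h0 h2
  have hκ0 : 0 < κ := by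
    obtain ⟨m, hm⟩ := h2
    exact div_pos (seriesEval_truncExp_pos hm (tauP_pos h0 ⟨m, hm⟩)) (by positivity)
  have hsκ : 0 < Real.sqrt κ := Real.sqrt_pos.2 hκ0
  have hsκ' : (Real.sqrt κ : ℂ) ≠ 0 := by exact_mod_cast hsκ.ne'
  -- the analytic square root `q` and its local inverse
  set q : ℂ → ℂ := fun u => ((tauP P : ℂ) - u) * h u ^ ((1 : ℂ) / 2) with hq
  have hroot : AnalyticAt ℂ (fun u => h u ^ ((1 : ℂ) / 2)) (tauP P) :=
    hana.cpow analyticAt_const (by rw [hτ]; exact Complex.ofReal_mem_slitPlane.2 hκ0)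
  have hqana : AnalyticAt ℂ q (tauP P) := (analyticAt_const.fun_sub analyticAt_id).fun_mul hroot
  have hq0 : q (tauP P) = 0 := by simp [hq]
  have hqd : HasDerivAt q (-(Real.sqrt κ : ℂ)) (tauP P) := by
    refine (((hasDerivAt_id' (tauP P : ℂ)).const_sub (tauP P : ℂ)).fun_mul
      hroot.differentiableAt.hasDerivAt).congr_deriv ?_
    rw [hτ, ofReal_cpow_half hκ0.le]
    ring
  have hqd' : deriv q (tauP P) ≠ 0 := by
    rw [hqd.deriv]
    exact neg_ne_zero.2 hsκ'
  have hq2 : ∀ z : ℂ, ‖z‖ ≤ rhoP P →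
      q (seriesEval (treeSeries P) z) ^ 2 = 1 - z / rhoP P := fun z hz => by
    have h1 := hh _ (truncExp_treeSeries_ne_zero h0 h2 hz)
    rw [treeSeries_div_truncExp h0 h2 hz] at h1
    rw [← h1]
    simp only [hq]
    rw [mul_pow, cpow_half_sq]
    ring
  have hQana := hqana.analyticAt_localInverse hqd'
  have hleft := hqana.hasStrictDerivAt.eventually_left_inverse hqd'
  have hQd := (hqana.hasStrictDerivAt.to_localInverse hqd').hasDerivAt
  have hQτ := hleft.self_of_nhds
  set Q := hqana.hasStrictDerivAt.localInverse _ _ _ hqd' with hQ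
  rw [hq0] at hQana hQd hQτ
  -- the square root of `1 - z / ρ`
  set w : ℂ → ℂ := fun z => (1 - z / rhoP P) ^ ((1 : ℂ) / 2) with hw
  have hw2 : ∀ z, w z ^ 2 = 1 - z / rhoP P := fun z => cpow_half_sq _
  have hwne : ∀ z : ℂ, z ∉ realRay (rhoP P) → w z ≠ 0 := fun z hz =>
    one_sub_div_cpow_half_ne_zero hρ hz
  have hwana : ∀ z : ℂ, z ∉ realRay (rhoP P) → AnalyticAt ℂ w z := fun z hz =>
    (analyticAt_const.fun_sub (analyticAt_id.fun_div analyticAt_const hρ')).cpow analyticAt_const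
      (one_sub_div_mem_slitPlane hρ hz)
  have hwlim : Tendsto w (𝓝 (rhoP P : ℂ)) (𝓝 0) := tendsto_one_sub_div_cpow_half hρ
  -- the radius `δ`
  have hT : Tendsto (seriesEval (treeSeries P)) (𝓝[Metric.ball 0 (rhoP P)] (rhoP P : ℂ))
      (𝓝 (tauP P : ℂ)) := by
    have hmem : (rhoP P : ℂ) ∈ Metric.closedBall (0 : ℂ) (rhoP P) := by
      rw [mem_closedBall_zero_iff, Complex.norm_of_nonneg hρ.le]
    have h1 := (continuousOn_treeSeries h0 h2 _ hmem).mono_left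
      (nhdsWithin_mono _ Metric.ball_subset_closedBall)
    rwa [treeSeries_rhoP h0 h2] at h1
  -- For `z` this close to `ρ`, `Q` is analytic at `w z`; if `z` also lies in the disc of
  -- convergence, `q` is analytic at `T(z)` and `Q` undoes `q` there.
  obtain ⟨δ, hδ, hball⟩ := Metric.eventually_nhds_iff_ball.1
    ((hwlim.eventually hQana.eventually_analyticAt).and (eventually_nhdsWithin_iff.1
      (hT.eventually (hqana.eventually_analyticAt.and hleft))))
  refine ⟨δ, hδ, fun z => Q (w z), fun z hz => ?_, ?_, ?_⟩
  · exact (hball z hz.1).1.comp (hwana z hz.2)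
  · set S := Metric.ball (rhoP P : ℂ) δ ∩ Metric.ball 0 (rhoP P) with hS
    have hSpre : IsPreconnected S := ((convex_ball _ _).inter (convex_ball _ _)).isPreconnected
    obtain ⟨x, hx0, hxρ, hxδ⟩ : ∃ x : ℝ, 0 ≤ x ∧ x < rhoP P ∧ rhoP P - δ < x :=
      ⟨max 0 (rhoP P - δ / 2), le_max_left _ _, max_lt hρ (by linarith),
        lt_of_lt_of_le (by linarith) (le_max_right _ _)⟩
    have hxS : (x : ℂ) ∈ S := by
      refine ⟨?_, ?_⟩
      · rw [mem_ball_iff_norm, ← Complex.ofReal_sub, Complex.norm_real, Real.norm_eq_abs, abs_lt]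
        constructor <;> linarith
      · rwa [mem_ball_zero_iff, Complex.norm_of_nonneg hx0]
    -- The sign of the square root is fixed at one real point `x < ρ`, where `τ - T(x) > 0`.
    have hxeq : q (seriesEval (treeSeries P) x) = w x := by
      obtain ⟨y, hyτ, hy⟩ := exists_treeSeries_ofReal_lt h0 h2 hx0 hxρ
      have hxn : ‖(x : ℂ)‖ ≤ rhoP P := by
        rw [Complex.norm_of_nonneg hx0]
        exact hxρ.le
      have h1 := hh _ (truncExp_treeSeries_ne_zero h0 h2 hxn)
      rw [treeSeries_div_truncExp h0 h2 hxn, hy] at h1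
      have hb : 0 ≤ 1 - x / rhoP P := sub_nonneg.2 ((div_le_one hρ).2 hxρ.le)
      have hc : 0 < tauP P - y := sub_pos.2 hyτ
      have hc' : ((tauP P - y : ℝ) : ℂ) ≠ 0 := by exact_mod_cast hc.ne'
      have hhy : h y = (((1 - x / rhoP P) / (tauP P - y) ^ 2 : ℝ) : ℂ) := by
        push_cast at hc' ⊢
        rw [eq_div_iff (pow_ne_zero 2 hc'), ← h1]
        ring
      simp only [hq, hw, hy]
      rw [hhy, ofReal_cpow_half (by positivity), Real.sqrt_div hb, Real.sqrt_sq hc.le,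
        show (1 : ℂ) - x / rhoP P = ((1 - x / rhoP P : ℝ) : ℂ) by push_cast; rfl,
        ofReal_cpow_half hb]
      push_cast at hc' ⊢
      field_simp
    have hqT : ContinuousOn (fun z => q (seriesEval (treeSeries P) z)) S := fun z hz =>
      ((((hball z hz.1).2 hz.2).1.continuousAt).comp
        ((analyticOnNhd_treeSeries h0 h2) z hz.2).continuousAt).continuousWithinAt
    have hwS : ContinuousOn w S := fun z hz =>
      (hwana z (notMem_realRay_of_mem_ball hz.2)).continuousAt.continuousWithinAt
    -- On the connected set `S` the squares agree and `w` has no zero, so the sign is constant.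
    have heq := hSpre.eq_of_sq_eq hqT hwS
      (fun z hz => (hq2 z (mem_ball_zero_iff.1 hz.2).le).trans (hw2 z).symm)
      (fun {z} hz => hwne z (notMem_realRay_of_mem_ball hz.2)) hxS hxeq
    intro z hz
    have h1 := ((hball z hz.1).2 hz.2).2
    have h3 : q (seriesEval (treeSeries P) z) = w z := heq hz
    rw [h3] at h1
    exact h1
  · have hslope := hasDerivAt_iff_tendsto_slope.1 hQd
    have hw' : Tendsto w (𝓝[(realRay (rhoP P))ᶜ] (rhoP P : ℂ)) (𝓝[≠] 0) :=
      tendsto_nhdsWithin_iff.2 ⟨hwlim.mono_left nhdsWithin_le_nhds,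
        eventually_nhdsWithin_of_forall fun z hz => hwne z hz⟩
    -- `Q'(0) = -1/√κ`, and `1/√κ` is the constant in `sqrtTerm`.
    have hlim := (hslope.comp hw').mul_const (-(Real.sqrt κ : ℂ))
    rw [hqd.deriv, inv_mul_cancel₀ (neg_ne_zero.2 hsκ')] at hlim
    refine hlim.congr fun z => ?_
    have hc : (Real.sqrt (2 * seriesEval (truncExp ℝ P) (tauP P) /
        seriesEval (truncExp ℝ (shiftDown P 2)) (tauP P)) : ℂ) = (Real.sqrt κ : ℂ)⁻¹ := by
      rw [hκ, ← Complex.ofReal_inv, ← Real.sqrt_inv, inv_div]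
    rw [Function.comp_apply, slope_def_field, hQτ, sub_zero, sqrtTerm, hc]
    change _ = (tauP P - Q (w z)) / ((Real.sqrt κ : ℂ)⁻¹ * w z)
    rw [div_mul_eq_mul_div, div_mul_eq_div_div, div_inv_eq_mul]
    ring

lemma tendsto_sqrtTerm : Tendsto (sqrtTerm P) (𝓝 (rhoP P : ℂ)) (𝓝 0) := by
  have h := (tendsto_one_sub_div_cpow_half (rhoP_pos h0 h2)).const_mul
    (Real.sqrt (2 * seriesEval (truncExp ℝ P) (tauP P) /
      seriesEval (truncExp ℝ (shiftDown P 2)) (tauP P)) : ℂ)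
  rwa [mul_zero] at h

lemma sqrtTerm_ne_zero {z : ℂ} (hz : z ∉ realRay (rhoP P)) : sqrtTerm P z ≠ 0 := by
  refine mul_ne_zero ?_ (one_sub_div_cpow_half_ne_zero (rhoP_pos h0 h2) hz)
  have h1 := seriesEval_tauP_pos h0 h2
  obtain ⟨m, hm⟩ := h2
  have h3 := seriesEval_truncExp_pos hm (tauP_pos h0 ⟨m, hm⟩)
  exact_mod_cast (Real.sqrt_pos.2 (by positivity)).ne'

-- If `ρ z` lies on the ray then `arg (z - 1) = 0`, so any positive angle would do.
omit h0 h2 in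
lemma isDeltaAnalytic_of_slit_ball {ρ r : ℝ} {T : ℂ → ℂ} (hρ : 0 < ρ) (hr : ρ < r)
    (hT : AnalyticOnNhd ℂ T (Metric.ball 0 r \ realRay ρ)) :
    IsDeltaAnalytic fun z => T ((ρ : ℂ) * z) := by
  refine ⟨Real.pi / 4, r / ρ, by positivity, by linarith [Real.pi_pos], (one_lt_div hρ).2 hr, ?_⟩
  rintro z ⟨hzr, hz1, hzarg⟩
  refine (hT _ ⟨?_, ?_⟩).comp (analyticAt_const.fun_mul analyticAt_id)
  · rw [mem_ball_zero_iff, norm_mul, Complex.norm_of_nonneg hρ.le]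
    rwa [lt_div_iff₀ hρ, mul_comm] at hzr
  · rintro ⟨x, hx, hxz⟩
    have hz : z - 1 = ((x / ρ - 1 : ℝ) : ℂ) := by
      have hρ' : (ρ : ℂ) ≠ 0 := by exact_mod_cast hρ.ne'
      push_cast
      rw [← hxz]
      exact congrArg (· - 1) (mul_div_cancel_left₀ z hρ').symm
    have h1 : 0 ≤ x / ρ - 1 := sub_nonneg.2 ((one_le_div hρ).2 hx)
    rw [hz, Complex.arg_ofReal_of_nonneg h1, abs_zero] at hzarg
    linarith [Real.pi_pos]

end Singularity

/-- Both functions tend to `τ ≠ 0`; the finer information is in the hypothesis on `τ - T`. -/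
lemma simAlong_of_tendsto {l : Filter ℂ} {τ : ℂ} {T s : ℂ → ℂ} (hτ : τ ≠ 0)
    (hs : Tendsto s l (𝓝 0)) (hs0 : ∀ᶠ z in l, s z ≠ 0)
    (hlim : Tendsto (fun z => (τ - T z) / s z) l (𝓝 1)) : SimAlong l T fun z => τ - s z := by
  have h1 : Tendsto (fun z => τ - T z) l (𝓝 0) := by
    have h2 := hlim.mul hs
    rw [mul_zero] at h2
    refine h2.congr' ?_
    filter_upwards [hs0] with z hz
    rw [div_mul_cancel₀ _ hz]
  have h2 : Tendsto T l (𝓝 τ) := by simpa using (tendsto_const_nhds (x := τ)).sub h1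
  have h3 : Tendsto (fun z => τ - s z) l (𝓝 τ) := by
    simpa using (tendsto_const_nhds (x := τ)).sub hs
  have h4 := h2.div h3 hτ
  rwa [div_self hτ] at h4

end

/-! ### The theorem -/

theorem mainTheorem5 (P : Set ℕ) (h0 : 0 ∈ P) (h2 : (shiftDown P 2).Nonempty) :
    HSchema (truncExp ℂ P) ∧
    (∃! τ : ℝ, IsCharacteristicRoot P τ) ∧
    seriesRadius (treeSeries P) = ENNReal.ofReal (rhoP P) ∧
    0 < rhoP P ∧
    ∃ T : ℂ → ℂ,
      Set.EqOn T (seriesEval (treeSeries P)) (Metric.ball 0 (rhoP P)) ∧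
      (∃ δ : ℝ, 0 < δ ∧ AnalyticOnNhd ℂ T
        (Metric.ball 0 (rhoP P) ∪ (Metric.ball (rhoP P : ℂ) δ \ realRay (rhoP P)))) ∧
      SimAlong (𝓝[(realRay (rhoP P))ᶜ] (rhoP P : ℂ))
        T (fun z => (tauP P : ℂ) - sqrtTerm P z) ∧
      SimAlong (𝓝[(realRay (rhoP P))ᶜ] (rhoP P : ℂ))
        (fun z => (tauP P : ℂ) - T z) (sqrtTerm P) ∧
      (Nat.setGcd P = 1 →
        (∃ r : ℝ, rhoP P < r ∧ AnalyticOnNhd ℂ T (Metric.ball 0 r \ realRay (rhoP P))) ∧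
        IsDeltaAnalytic (fun z => T ((rhoP P : ℂ) * z))) := by
  classical
  have hρ := rhoP_pos h0 h2
  refine ⟨hSchema_truncExp h0 h2, existsUnique_isCharacteristicRoot h0 h2,
    seriesRadius_treeSeries h0 h2, hρ, ?_⟩
  obtain ⟨δ, hδ, g, hg, hgf, hlim⟩ := exists_sqrt_extension h0 h2
  have hf := analyticOnNhd_treeSeries h0 h2
  obtain ⟨T, hTf, hTg, hTr⟩ : ∃ T : ℂ → ℂ,
      Set.EqOn T (seriesEval (treeSeries P)) (Metric.ball 0 (rhoP P)) ∧
      Set.EqOn T g (Metric.ball (rhoP P : ℂ) δ \ realRay (rhoP P)) ∧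
      (Nat.setGcd P = 1 → ∃ r : ℝ, rhoP P < r ∧
        AnalyticOnNhd ℂ T (Metric.ball 0 r \ realRay (rhoP P))) := by
    -- One function `T` must serve all the claims, so it is chosen according to the gcd; otherwise
    -- the disc and the slit disc around `ρ` suffice.
    by_cases hP : Nat.setGcd P = 1
    · obtain ⟨r, hr, F, hF, hFf, hFg⟩ := exists_extension_slit_ball hρ hδ hf hg hgf
        fun x hx hne => exists_extension_of_norm_eq h0 h2 hP hx hne
      exact ⟨F, hFf, hFg, fun _ => ⟨r, hr, hF⟩⟩
    · refine ⟨(Metric.ball (0 : ℂ) (rhoP P)).piecewise (seriesEval (treeSeries P)) g,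
        Set.piecewise_eqOn _ _ _, fun z hz => ?_, fun h => absurd h hP⟩
      by_cases hzρ : z ∈ Metric.ball (0 : ℂ) (rhoP P)
      · rw [Set.piecewise_eq_of_mem _ _ _ hzρ, hgf ⟨hz.1, hzρ⟩]
      · rw [Set.piecewise_eq_of_notMem _ _ _ hzρ]
  have hmem : Metric.ball (rhoP P : ℂ) δ \ realRay (rhoP P) ∈
      𝓝[(realRay (rhoP P))ᶜ] (rhoP P : ℂ) :=
    Filter.inter_mem (mem_nhdsWithin_of_mem_nhds (Metric.ball_mem_nhds _ hδ)) self_mem_nhdsWithin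
  have hsim : Tendsto (fun z => ((tauP P : ℂ) - T z) / sqrtTerm P z)
      (𝓝[(realRay (rhoP P))ᶜ] (rhoP P : ℂ)) (𝓝 1) := by
    refine hlim.congr' ?_
    filter_upwards [hmem] with z hz
    rw [hTg hz]
  refine ⟨T, hTf, ⟨δ, hδ, ?_⟩, ?_, hsim, fun hP => ?_⟩
  · rintro z (hz | hz)
    · exact (hf z hz).congr (hTf.symm.eventuallyEq_of_mem (Metric.isOpen_ball.mem_nhds hz))
    · exact (hg z hz).congr (hTg.symm.eventuallyEq_of_mem
        ((Metric.isOpen_ball.sdiff (isClosed_realRay _)).mem_nhds hz))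
  · refine simAlong_of_tendsto (by exact_mod_cast (tauP_pos h0 h2).ne') ?_ ?_ hsim
    · exact (tendsto_sqrtTerm h0 h2).mono_left nhdsWithin_le_nhds
    · exact eventually_nhdsWithin_of_forall fun z hz => sqrtTerm_ne_zero h0 h2 hz
  · obtain ⟨r, hr, hT⟩ := hTr hP
    exact ⟨⟨r, hr, hT⟩, isDeltaAnalytic_of_slit_ball hρ hr hT⟩
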